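/- Let $H$ and $U$ be real Hilbert spaces, let $A:D(A)\subset H\to H$ generate a strongly continuous semigroup of contractions on $H$, let $B\in\mathcal L(U,H)$ and $k>0$, and put $\|z\|_{D(A)}=\|z\|_H+\|Az\|_H$. Assume that the origin of $z'=(A-kBB^\star)z$ is globally exponentially stable: the semigroup generated by $A-kBB^\star$ (with domain $D(A)$) satisfies $\|e^{t(A-kBB^\star)}z_0\|_H\le Ce^{-\alpha t}\|z_0\|_H$ for all $z_0\in H$, $t\ge0$, with some constants $C,\alpha>0$. Let $S$ be a real Banach space, densely and continuously embedded in $U$, so that $S\subseteq U=U'\subseteq S'$, and for $u\in U$ let $\|u\|_{S'}=\sup\{\langle u,s\rangle_U : s\in S,\ \|s\|_S\le 1\}$. Let $\sigma:U\to S$ be such that - $\sigma$ is locally Lipschitz as a map from $U$ to $U$; - there are $C_1,C_2>0$ and a continuous non-decreasing $h:\mathbb R\to[0,\infty)$ with $h(0)>0$ such that $\|\sigma(s)-C_1s\|_{S'}\le C_2\,h(\|s\|_S)\,\langle\sigma(s),s\rangle_U$ for all $s\in S$. Let $A_\sigma(z)=Az-\sqrt k\,B\sigma(\sqrt k\,B^\star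 z)$ for $z\in D(A)$, and consider $z'=A_\sigma(z)$. A strong solution on an interval is an absolutely continuous function $z$ with $z(t)\in D(A)$ and $z'(t)=A_\sigma(z(t))$ for almost every $t$. 1. If $S=U$ (with equal norms), then there are a self-adjoint coercive $P\in\mathcal L(H)$ and constants $M,C>0$ such that $$\langle (A-kC_1BB^\star)z,Pz\rangle_H+\langle Pz,(A-kC_1BB^\star)z\rangle_H\le -C\|z\|_H^2\qquad(z\in D(A)),$$ and such that $$V(z)=\langle Pz,z\rangle_H+M\int_0^{\|z\|_H^2}\sqrt v\,h\big(\sqrt k\,\|B\|\sqrt v\big)\,dv$$ is a strict global Lyapunov function for $z'=A_\sigma(z)$. That is, $V$ is of class $C^1$ on $H$; there are continuous, strictly increasing, unbounded functions $\psi_1,\psi_2$ on $[0,\infty)$, vanishing at $0$, with $\psi_1(\|z\|_H)\le V(z)\le\psi_2(\|z\|_H)$ for all $z\in H$; $DV(z)[A_\sigma(z)]\le -C\|z\|_H^2$ for all $z\in D(A)$; and along every strong solution on an interval $[0,\tau]$ the function $V(z(\cdot))$ is absolutely continuous with $\frac{d}{dt}V(z(t))\le -C\|z(t)\|_H^2$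 for almost every $t$. 2. For general $S$ (in particular $S\ne U$), suppose in addition that $\sigma$ is monotone, i.e. $\langle\sigma(s_1)-\sigma(s_2),s_1-s_2\rangle_U\ge0$ for all $s_1,s_2\in U$, that $\sigma$ maps bounded subsets of $U$ to bounded subsets of $U$, and that there is a constant $c_S$ such that $B^\star z\in S$ and $\|B^\star z\|_S\le c_S\|z\|_{D(A)}$ for all $z\in D(A)$. Then the origin of $z'=A_\sigma(z)$ is semi-globally exponentially stable in $D(A)$: for every $z_0\in D(A)$ there is a unique strong solution $t\mapsto W_\sigma(t)z_0$ on $[0,\infty)$ with $W_\sigma(0)z_0=z_0$, and for every $r>0$ there are $K,\mu>0$ such that $\|W_\sigma(t)z_0\|_H\le Ke^{-\mu t}\|z_0\|_H$ for all $t\ge0$ and all $z_0\in D(A)$ with $\|z_0\|_{D(A)}\le r$. -/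

import Mathlib

open Set Filter Topology MeasureTheory
open scoped NNReal InnerProductSpace

namespace NonlinearDamping

noncomputable section

/-- `(T t)_{t ≥ 0}` is a strongly continuous semigroup of bounded operators on `H`
(only the values at `t ≥ 0` matter). -/
structure IsC0Semigroup {H : Type*} [NormedAddCommGroup H] [NormedSpace ℝ H]
    (T : ℝ → H →L[ℝ] H) : Prop where
  map_zero : T 0 = ContinuousLinearMap.id ℝ H
  map_add : ∀ s t : ℝ, 0 ≤ s → 0 ≤ t → T (s + t) = (T s).comp (T t)
  continuousOn : ∀ z : H, ContinuousOn (fun t => T t z) (Ici 0)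

/-- `A` is the infinitesimal generator of `T`: its domain consists of those `z` for which
`(T t z - z) / t` converges as `t ↓ 0`, and `A z` is the limit. -/
def IsGenerator {H : Type*} [NormedAddCommGroup H] [NormedSpace ℝ H]
    (T : ℝ → H →L[ℝ] H) (A : H →ₗ.[ℝ] H) : Prop :=
  ∀ z y : H, (z, y) ∈ A.graph ↔
    Tendsto (fun t : ℝ => t⁻¹ • (T t z - z)) (𝓝[>] 0) (𝓝 y)

/-- `A` generates a strongly continuous semigroup of contractions. -/
def GeneratesContractionSemigroup {H : Type*} [NormedAddCommGroup H] [NormedSpace ℝ H]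
    (A : H →ₗ.[ℝ] H) : Prop :=
  ∃ T : ℝ → H →L[ℝ] H, IsC0Semigroup T ∧ IsGenerator T A ∧ ∀ t : ℝ, 0 ≤ t → ‖T t‖ ≤ 1

/-- The origin of `z' = L z` is globally exponentially stable: `L` generates a strongly
continuous semigroup that decays exponentially, uniformly on bounded sets of initial data. -/
def GloballyExpStable {H : Type*} [NormedAddCommGroup H] [NormedSpace ℝ H]
    (L : H →ₗ.[ℝ] H) : Prop :=
  ∃ T : ℝ → H →L[ℝ] H, IsC0Semigroup T ∧ IsGenerator T L ∧
    ∃ C > 0, ∃ α > 0, ∀ (z₀ : H) (t : ℝ), 0 ≤ t →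
      ‖T t z₀‖ ≤ C * Real.exp (-α * t) * ‖z₀‖

/-- The graph norm `‖z‖_{D(A)} = ‖z‖ + ‖A z‖`. -/
def graphNorm {H : Type*} [NormedAddCommGroup H] [NormedSpace ℝ H]
    (A : H →ₗ.[ℝ] H) (z : A.domain) : ℝ :=
  ‖(z : H)‖ + ‖A z‖

section

variable {H : Type*} [NormedAddCommGroup H] [InnerProductSpace ℝ H] [CompleteSpace H]
  {U : Type*} [NormedAddCommGroup U] [InnerProductSpace ℝ U] [CompleteSpace U]
  {S : Type*} [NormedAddCommGroup S] [NormedSpace ℝ S]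

/-- The linear operator `A - k B B*`, with domain `D(A)`. -/
def linearClosedLoop (A : H →ₗ.[ℝ] H) (B : U →L[ℝ] H) (k : ℝ) : H →ₗ.[ℝ] H where
  domain := A.domain
  toFun := A.toFun -
    (k • (B.comp (ContinuousLinearMap.adjoint B)).toLinearMap).comp A.domain.subtype

/-- `S` is densely and continuously embedded in the Hilbert space `U` by `ι`, so that
`S ⊆ U = U' ⊆ S'` (the pairing of `S` with `U ⊆ S'` being the inner product of `U`). -/
structure IsRigging (ι : S →L[ℝ] U) : Prop where
  injective : Function.Injective ι
  dense : DenseRange ι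

/-- The norm `‖u‖_{S'}` of `u ∈ U` as the functional `s ↦ ⟨u, s⟩_U` on `S`. -/
def dualNorm (ι : S →L[ℝ] U) (u : U) : ℝ :=
  ‖(innerSL ℝ u).comp ι‖

/-- The admissible gain functions `h : ℝ → ℝ₊`. -/
structure IsGain (h : ℝ → ℝ) : Prop where
  continuous : Continuous h
  mono : Monotone h
  nonneg : ∀ x, 0 ≤ h x
  pos_zero : 0 < h 0

/-- `‖σ(s) - C₁ s‖_{S'} ≤ C₂ h(‖s‖_S) ⟨σ(s), s⟩_U`, for all `s` at which `‖s‖_S` makes sense,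
that is, for all `s ∈ S`. -/
def DampingInequality (ι : S →L[ℝ] U) (σ : U → S) (C₁ C₂ : ℝ) (h : ℝ → ℝ) : Prop :=
  ∀ s : S, dualNorm ι (ι (σ (ι s)) - C₁ • ι s) ≤ C₂ * h ‖s‖ * ⟪ι (σ (ι s)), ι s⟫_ℝ

/-- `⟨σ(s₁) - σ(s₂), s₁ - s₂⟩_U ≥ 0` for all `s₁, s₂ ∈ U`. -/
def MonotoneDamping (ι : S →L[ℝ] U) (σ : U → S) : Prop :=
  ∀ s₁ s₂ : U, 0 ≤ ⟪ι (σ s₁) - ι (σ s₂), s₁ - s₂⟫_ℝ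

/-- The nonlinear operator `A_σ z = A z - √k B σ(√k B* z)`, with domain `D(A)`. -/
def nonlinearClosedLoop (A : H →ₗ.[ℝ] H) (B : U →L[ℝ] H) (k : ℝ) (ι : S →L[ℝ] U) (σ : U → S)
    (z : A.domain) : H :=
  A z - √k • B (ι (σ (√k • ContinuousLinearMap.adjoint B (z : H))))

/-- `z` is a strong solution of `z' = F(z)` on `[0, τ]`, where `F` is a (nonlinear) operator with
domain `D`: it is absolutely continuous, and for almost every `t` it is differentiable at `t`
with `z(t) ∈ D` and `z'(t) = F(z(t))`. -/
structure IsStrongSolutionOn {D : Submodule ℝ H} (F : D → H) (τ : ℝ) (z : ℝ → H) : Prop where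
  absCont : AbsolutelyContinuousOnInterval z 0 τ
  ode : ∀ᵐ t : ℝ, t ∈ Ioo 0 τ → ∃ ht : z t ∈ D, HasDerivAt z (F ⟨z t, ht⟩) t

/-- Strong solution on `[0, ∞)` with initial value `z₀`. -/
structure IsStrongSolution {D : Submodule ℝ H} (F : D → H) (z₀ : H) (z : ℝ → H) : Prop where
  init : z 0 = z₀
  sol : ∀ τ > 0, IsStrongSolutionOn F τ z

/-- A comparison function of class `K∞`. -/
structure IsClassKInfty (ψ : ℝ → ℝ) : Prop where
  continuousOn : ContinuousOn ψ (Ici 0)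
  strictMonoOn : StrictMonoOn ψ (Ici 0)
  map_zero : ψ 0 = 0
  tendsto : Tendsto ψ atTop atTop

/-- `V : H → ℝ` is a strict global Lyapunov function for `z' = F(z)`: it is of class `C¹`,
positive definite and coercive, and it decreases at a rate at least `C ‖z‖²`, both
infinitesimally on the whole domain of `F` and along every strong solution. -/
structure IsStrictGlobalLyapunov {D : Submodule ℝ H} (F : D → H) (V : H → ℝ) (C : ℝ) :
    Prop where
  contDiff : ContDiff ℝ 1 V
  bounds : ∃ ψ₁ ψ₂ : ℝ → ℝ, IsClassKInfty ψ₁ ∧ IsClassKInfty ψ₂ ∧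
    ∀ z : H, ψ₁ ‖z‖ ≤ V z ∧ V z ≤ ψ₂ ‖z‖
  rate_pos : 0 < C
  dissipation : ∀ z : D, fderiv ℝ V (z : H) (F z) ≤ -C * ‖(z : H)‖ ^ 2
  along_solutions : ∀ (τ : ℝ) (z : ℝ → H), 0 < τ → IsStrongSolutionOn F τ z →
    AbsolutelyContinuousOnInterval (fun t => V (z t)) 0 τ ∧
    ∀ᵐ t : ℝ, t ∈ Ioo 0 τ →
      ∃ d : ℝ, HasDerivAt (fun s => V (z s)) d t ∧ d ≤ -C * ‖z t‖ ^ 2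

/-- The function `z ↦ ⟨P z, z⟩ + M ∫₀^{‖z‖²} √v h(b √v) dv`. -/
def lyapunovFunction (P : H →L[ℝ] H) (M : ℝ) (h : ℝ → ℝ) (b : ℝ) (z : H) : ℝ :=
  ⟪P z, z⟫_ℝ + M * ∫ v in (0 : ℝ)..(‖z‖ ^ 2), √v * h (b * √v)

/-- `W` is the flow of strong solutions of `z' = F(z)`: for every `z₀` in the domain of `F`,
`t ↦ W t z₀` is the unique strong solution on `[0, ∞)` issued from `z₀`. -/
def IsStrongFlow {D : Submodule ℝ H} (F : D → H) (W : ℝ → H → H) : Prop :=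
  ∀ z₀ : D, IsStrongSolution F z₀ (fun t => W t z₀) ∧
    ∀ z : ℝ → H, IsStrongSolution F z₀ z → ∀ t : ℝ, 0 ≤ t → z t = W t z₀

/-- The origin of `z' = F(z)`, with `F` defined on `D(A)`, is semi-globally exponentially stable
in `D(A)`: strong solutions exist uniquely, and on every ball of `D(A)` they decay exponentially
in `H` with constants that depend on the radius only. -/
def SemiGloballyExpStable (A : H →ₗ.[ℝ] H) (F : A.domain → H) : Prop :=
  ∃ W : ℝ → H → H, IsStrongFlow F W ∧
    ∀ r > 0, ∃ K > 0, ∃ μ > 0, ∀ z₀ : A.domain, graphNorm A z₀ ≤ r →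
      ∀ t : ℝ, 0 ≤ t → ‖W t z₀‖ ≤ K * Real.exp (-μ * t) * ‖(z₀ : H)‖

end

end

end NonlinearDamping

open NonlinearDamping

/-!
Writing `√k B` for `B`, one may assume `k = 1`. Exponential stability of the linear closed loop
turns its Gramian `∫₀^τ ‖e^{tL} z‖² dt` into a quadratic form that decreases along the linear flow;
adding a multiple of `‖z‖²` makes it coercive and absorbs the change of gain from `1` to `C₁`.

Along the nonlinear system the quadratic form only picks up the defect `⟪σ(s) - C₁ s, B* P z⟫` with
`s = B* z`, which the damping inequality bounds by `‖z‖ h(‖s‖) ⟪σ(s), s⟫`. Since `⟪σ(s), s⟫` is the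
rate at which `‖z‖² / 2` is dissipated, the weight `√v h(‖B‖ √v)` in the second term of the Lyapunov
function is exactly what compensates this defect.

When `S ≠ U` the defect is controlled only while `B* z` stays bounded in `S`. A monotone damping
makes the closed loop dissipative, so the speed `‖A_σ z‖` does not increase along solutions and the
graph norm of `z(t)` remains bounded in terms of that of `z(0)`. If `w` is the linear flow issued
from `z(0)`, the damping inequality then makes `‖z - w‖² + c ‖z‖²` non-increasing; by the time `τ`
at which the linear flow has halved, `‖z‖` has contracted by a fixed factor `q < 1`.
-/

namespace NonlinearDamping

/-! ### Contraction semigroups -/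

section Semigroup

variable {H : Type*} [NormedAddCommGroup H] [NormedSpace ℝ H]

/-- A strongly continuous semigroup of contractions. Its values at negative times carry no meaning:
they are only there to make `T` jointly continuous on `ℝ × H`. -/
structure IsContractionSemigroup (T : ℝ → H →L[ℝ] H) : Prop where
  map_zero : T 0 = ContinuousLinearMap.id ℝ H
  map_add : ∀ s t : ℝ, 0 ≤ s → 0 ≤ t → T (s + t) = (T s).comp (T t)
  norm_le : ∀ t, ‖T t‖ ≤ 1
  continuous_uncurry : Continuous fun p : ℝ × H => T p.1 p.2

variable {T T' : ℝ → H →L[ℝ] H} {A : H →ₗ.[ℝ] H} {x y : H} {t : ℝ}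

theorem IsContractionSemigroup.norm_apply_le (hT : IsContractionSemigroup T) (t : ℝ) (x : H) :
    ‖T t x‖ ≤ ‖x‖ := by
  simpa using (T t).le_of_opNorm_le (hT.norm_le t) x

theorem IsContractionSemigroup.continuous_apply (hT : IsContractionSemigroup T) {X : Type*}
    [TopologicalSpace X] {a : X → ℝ} {f : X → H} (ha : Continuous a) (hf : Continuous f) :
    Continuous fun x => T (a x) (f x) :=
  hT.continuous_uncurry.comp (ha.prodMk hf)

theorem IsGenerator.congr (hA : IsGenerator T A) (hTT' : ∀ t, 0 ≤ t → T t = T' t) :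
    IsGenerator T' A := by
  intro z y
  rw [hA z y]
  refine tendsto_congr' ?_
  filter_upwards [self_mem_nhdsWithin] with t ht
  rw [hTT' t (le_of_lt ht)]

theorem GeneratesContractionSemigroup.exists_isContractionSemigroup
    (hA : GeneratesContractionSemigroup A) :
    ∃ T : ℝ → H →L[ℝ] H, IsContractionSemigroup T ∧ IsGenerator T A := by
  obtain ⟨T, hT, hgen, hnorm⟩ := hA
  have hmax : ∀ t, 0 ≤ t → T t = T (max t 0) := fun t ht => by rw [max_eq_left ht]
  refine ⟨fun t => T (max t 0), ⟨by simpa using hT.map_zero, fun s t hs ht => ?_,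
    fun t => hnorm _ (le_max_right _ _), ?_⟩, hgen.congr hmax⟩
  · simp only [← hmax _ hs, ← hmax _ ht, ← hmax _ (add_nonneg hs ht)]
    exact hT.map_add s t hs ht
  · refine continuous_prod_of_continuous_lipschitzWith' _ 1 (fun t => ?_) fun z => ?_
    · exact (T (max t 0)).lipschitz.weaken (by exact_mod_cast hnorm _ (le_max_right t 0))
    · exact (hT.continuousOn z).comp_continuous (continuous_id.max continuous_const)
        fun t => le_max_right t 0

theorem IsGenerator.map_mem_graph (hA : IsGenerator T A) (hT : IsC0Semigroup T)
    (hxy : (x, y) ∈ A.graph) (ht : 0 ≤ t) : (T t x, T t y) ∈ A.graph := by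
  rw [hA] at hxy ⊢
  refine (((T t).continuous.tendsto y).comp hxy).congr' ?_
  filter_upwards [self_mem_nhdsWithin] with h hh
  have hcomm : T h (T t x) = T t (T h x) := by
    rw [← ContinuousLinearMap.comp_apply, ← hT.map_add h t (le_of_lt hh) ht, add_comm,
      hT.map_add t h ht (le_of_lt hh), ContinuousLinearMap.comp_apply]
  simp only [Function.comp_apply, map_smul, map_sub, hcomm]

theorem hasDerivWithinAt_Ici_iff_tendsto {f : ℝ → H} {f' : H} :
    HasDerivWithinAt f f' (Ici t) t ↔
      Tendsto (fun h : ℝ => h⁻¹ • (f (t + h) - f t)) (𝓝[>] 0) (𝓝 f') := by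
  have hmap : 𝓝[>] t = map (fun h => t + h) (𝓝[>] 0) := by simp
  rw [hasDerivWithinAt_iff_tendsto_slope, Ici_sdiff_left, hmap, tendsto_map'_iff]
  refine tendsto_congr fun h => ?_
  simp [slope_def_module]

theorem IsGenerator.hasDerivWithinAt_orbit (hA : IsGenerator T A) (hT : IsC0Semigroup T)
    (hxy : (x, y) ∈ A.graph) (ht : 0 ≤ t) :
    HasDerivWithinAt (fun s => T s x) (T t y) (Ici t) t := by
  rw [hasDerivWithinAt_Ici_iff_tendsto]
  refine ((hA _ _).1 (hA.map_mem_graph hT hxy ht)).congr' ?_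
  filter_upwards [self_mem_nhdsWithin] with h hh
  rw [add_comm t h, hT.map_add h t (le_of_lt hh) ht, ContinuousLinearMap.comp_apply]

end Semigroup

/-! ### Mild solutions -/

section Mild

theorem tendsto_average_intervalIntegral {E : Type*} [NormedAddCommGroup E] [NormedSpace ℝ E]
    [CompleteSpace E] {φ : ℝ → ℝ → E} (hφ : Continuous (Function.uncurry φ)) :
    Tendsto (fun h : ℝ => h⁻¹ • ∫ s in (0 : ℝ)..h, φ h s) (𝓝[>] 0) (𝓝 (φ 0 0)) := by
  have hrescaled : Continuous fun h : ℝ => ∫ θ in (0 : ℝ)..1, φ h (h * θ) :=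
    intervalIntegral.continuous_parametric_intervalIntegral_of_continuous' (by fun_prop) 0 1
  have hlim := hrescaled.continuousWithinAt (s := Ioi 0) (x := 0)
  simp only [ContinuousWithinAt, zero_mul, intervalIntegral.integral_const, sub_zero,
    one_smul] at hlim
  refine hlim.congr' ?_
  filter_upwards [self_mem_nhdsWithin] with h hh
  rw [intervalIntegral.integral_comp_mul_left _ (ne_of_gt hh), mul_zero, mul_one]

variable {H : Type*} [NormedAddCommGroup H] [NormedSpace ℝ H] {T : ℝ → H →L[ℝ] H}
  {f g z w : ℝ → H} {τ : ℝ}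

/-- The variation-of-constants integral: `duhamel T f` solves `z' = A z + f`, `z 0 = 0`, where `A`
is the generator of `T`. -/
noncomputable def duhamel (T : ℝ → H →L[ℝ] H) (f : ℝ → H) (t : ℝ) : H :=
  ∫ s in (0 : ℝ)..t, T (t - s) (f s)

theorem IsContractionSemigroup.continuous_duhamel_kernel (hT : IsContractionSemigroup T)
    (hf : Continuous f) : Continuous (Function.uncurry fun t s : ℝ => T (t - s) (f s)) :=
  hT.continuous_apply (by fun_prop) (by fun_prop)

theorem IsContractionSemigroup.intervalIntegrable_duhamel_kernel (hT : IsContractionSemigroup T)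
    (hf : Continuous f) (t a b : ℝ) :
    IntervalIntegrable (fun s => T (t - s) (f s)) volume a b :=
  ((hT.continuous_duhamel_kernel hf).comp (Continuous.prodMk_right t)).intervalIntegrable a b

theorem IsContractionSemigroup.continuous_duhamel (hT : IsContractionSemigroup T)
    (hf : Continuous f) : Continuous (duhamel T f) :=
  intervalIntegral.continuous_parametric_intervalIntegral_of_continuous
    (hT.continuous_duhamel_kernel hf) continuous_id

theorem duhamel_congr {t : ℝ} (ht : 0 ≤ t) (hfg : EqOn f g (Icc 0 t)) :
    duhamel T f t = duhamel T g t := by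
  refine intervalIntegral.integral_congr fun s hs => ?_
  rw [uIcc_of_le ht] at hs
  simp only [hfg hs]

theorem IsContractionSemigroup.duhamel_sub (hT : IsContractionSemigroup T) (hf : Continuous f)
    (hg : Continuous g) (t : ℝ) :
    duhamel T (fun s => f s - g s) t = duhamel T f t - duhamel T g t := by
  simp only [duhamel, map_sub]
  exact intervalIntegral.integral_sub (hT.intervalIntegrable_duhamel_kernel hf t 0 t)
    (hT.intervalIntegrable_duhamel_kernel hg t 0 t)

theorem IsContractionSemigroup.norm_duhamel_le (hT : IsContractionSemigroup T) {C t : ℝ}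
    (ht : 0 ≤ t) (hf : ∀ s ∈ Icc 0 t, ‖f s‖ ≤ C) : ‖duhamel T f t‖ ≤ C * t := by
  have hbound : ∀ s ∈ uIoc 0 t, ‖T (t - s) (f s)‖ ≤ C := fun s hs => by
    rw [uIoc_of_le ht] at hs
    exact (hT.norm_apply_le _ _).trans (hf s (Ioc_subset_Icc_self hs))
  simpa [duhamel, abs_of_nonneg ht] using intervalIntegral.norm_integral_le_of_norm_le_const hbound

theorem IsContractionSemigroup.duhamel_add [CompleteSpace H] (hT : IsContractionSemigroup T)
    (hf : Continuous f) {a h : ℝ} (ha : 0 ≤ a) (hh : 0 ≤ h) :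
    duhamel T f (a + h) = T h (duhamel T f a) + duhamel T (fun s => f (a + s)) h := by
  have hint := fun t => hT.intervalIntegrable_duhamel_kernel hf t
  have hpast : ∫ s in (0 : ℝ)..a, T (a + h - s) (f s) = T h (duhamel T f a) := by
    rw [duhamel, ← (T h).intervalIntegral_comp_comm (hint a 0 a)]
    refine intervalIntegral.integral_congr fun s hs => ?_
    rw [uIcc_of_le ha] at hs
    simp only [show a + h - s = h + (a - s) by ring, hT.map_add h (a - s) hh (sub_nonneg.2 hs.2),
      ContinuousLinearMap.comp_apply]
  have hrecent : ∫ s in a..(a + h), T (a + h - s) (f s) = duhamel T (fun s => f (a + s)) h := by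
    have hshift := intervalIntegral.integral_comp_add_left (a := 0) (b := h)
      (fun s => T (a + h - s) (f s)) a
    simpa only [duhamel, add_zero, add_sub_add_left_eq_sub] using hshift.symm
  rw [← hpast, ← hrecent]
  exact (intervalIntegral.integral_add_adjacent_intervals (hint _ _ _) (hint _ _ _)).symm

/-- `z` is a mild solution on `[0, τ]` of `z' = A z + f`, where `A` generates `T`. A mild solution
of `z' = A z + G(z)` is a mild solution for the forcing term `G ∘ z`. -/
structure IsMildSolution (T : ℝ → H →L[ℝ] H) (f : ℝ → H) (τ : ℝ) (z : ℝ → H) : Prop where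
  continuous_forcing : Continuous f
  continuous : Continuous z
  eq : ∀ t ∈ Icc 0 τ, z t = T t (z 0) + duhamel T f t

namespace IsMildSolution

theorem mono (hz : IsMildSolution T f τ z) {τ' : ℝ} (h : τ' ≤ τ) : IsMildSolution T f τ' z :=
  ⟨hz.continuous_forcing, hz.continuous, fun t ht => hz.eq t ⟨ht.1, ht.2.trans h⟩⟩

theorem congr (hz : IsMildSolution T f τ z) (hg : Continuous g) (hw : Continuous w)
    (hfg : EqOn f g (Icc 0 τ)) (hzw : EqOn z w (Icc 0 τ)) : IsMildSolution T g τ w := by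
  refine ⟨hg, hw, fun t ht => ?_⟩
  rw [← hzw ht, ← hzw ⟨le_rfl, ht.1.trans ht.2⟩, hz.eq t ht,
    duhamel_congr ht.1 (hfg.mono (Icc_subset_Icc_right ht.2))]

theorem sub (hT : IsContractionSemigroup T) (hz : IsMildSolution T f τ z)
    (hw : IsMildSolution T g τ w) :
    IsMildSolution T (fun t => f t - g t) τ (fun t => z t - w t) := by
  refine ⟨hz.continuous_forcing.sub hw.continuous_forcing, hz.continuous.sub hw.continuous,
    fun t ht => ?_⟩
  rw [hz.eq t ht, hw.eq t ht, hT.duhamel_sub hz.continuous_forcing hw.continuous_forcing, map_sub]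
  abel

variable [CompleteSpace H]

theorem eq_add (hT : IsContractionSemigroup T) (hz : IsMildSolution T f τ z) {a h : ℝ}
    (ha : 0 ≤ a) (hh : 0 ≤ h) (hah : a + h ≤ τ) :
    z (a + h) = T h (z a) + duhamel T (fun s => f (a + s)) h := by
  rw [hz.eq (a + h) ⟨by positivity, hah⟩, hz.eq a ⟨ha, by linarith⟩,
    hT.duhamel_add hz.continuous_forcing ha hh, add_comm a h, hT.map_add h a hh ha, map_add,
    ContinuousLinearMap.comp_apply, add_assoc]

theorem shift (hT : IsContractionSemigroup T) (hz : IsMildSolution T f τ z) {a : ℝ}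
    (ha : 0 ≤ a) : IsMildSolution T (fun t => f (a + t)) (τ - a) fun t => z (a + t) := by
  refine ⟨hz.continuous_forcing.comp (by fun_prop), hz.continuous.comp (by fun_prop),
    fun t ht => ?_⟩
  rw [add_zero]
  exact hz.eq_add hT ha ht.1 (by linarith [ht.2])

theorem append (hT : IsContractionSemigroup T) {δ : ℝ} (hτ : 0 ≤ τ)
    (hz : IsMildSolution T f τ z)
    (hz' : IsMildSolution T (fun t => f (τ + t)) δ fun t => z (τ + t)) :
    IsMildSolution T f (τ + δ) z := by
  refine ⟨hz.continuous_forcing, hz.continuous, fun t ht => ?_⟩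
  rcases le_total t τ with htτ | htτ
  · exact hz.eq t ⟨ht.1, htτ⟩
  · obtain ⟨h, rfl⟩ : ∃ h, t = τ + h := ⟨t - τ, by ring⟩
    have hh : 0 ≤ h := by linarith
    rw [hz'.eq h ⟨hh, by linarith [ht.2]⟩, add_zero, hz.eq τ ⟨hτ, le_rfl⟩,
      hT.duhamel_add hz.continuous_forcing hτ hh, add_comm τ h, hT.map_add h τ hh hτ, map_add,
      ContinuousLinearMap.comp_apply, add_assoc]

theorem tendsto_expansion (hT : IsContractionSemigroup T) (hz : IsMildSolution T f τ z) {t : ℝ}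
    (ht : t ∈ Ico 0 τ) :
    Tendsto (fun h : ℝ => h⁻¹ • (z (t + h) - T h (z t))) (𝓝[>] 0) (𝓝 (f t)) := by
  have hf : Continuous fun s => f (t + s) := hz.continuous_forcing.comp (by fun_prop)
  have havg := tendsto_average_intervalIntegral (hT.continuous_duhamel_kernel hf)
  simp only [sub_zero, add_zero, hT.map_zero, ContinuousLinearMap.id_apply] at havg
  refine havg.congr' ?_
  filter_upwards [Ioo_mem_nhdsGT (sub_pos.2 ht.2)] with h hh
  rw [hz.eq_add hT ht.1 hh.1.le (by linarith [hh.2]), add_sub_cancel_left, duhamel]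

theorem hasDerivWithinAt (hT : IsContractionSemigroup T) {A : H →ₗ.[ℝ] H} (hA : IsGenerator T A)
    (hz : IsMildSolution T f τ z) {t : ℝ} (ht : t ∈ Ico 0 τ) {y : H} (hy : (z t, y) ∈ A.graph) :
    HasDerivWithinAt z (y + f t) (Ici t) t := by
  rw [hasDerivWithinAt_Ici_iff_tendsto]
  refine (((hA _ _).1 hy).add (hz.tendsto_expansion hT ht)).congr fun h => ?_
  rw [← smul_add]
  congr 1
  abel

end IsMildSolution

end Mild

/-! ### Dissipative perturbations -/

section Dissipative

theorem le_add_mul_of_frequently_right {f : ℝ → ℝ} {a b c : ℝ} (hf : ContinuousOn f (Icc a b))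
    (hslope : ∀ s ∈ Ico a b, ∀ r > c, ∃ᶠ h in 𝓝[>] (0 : ℝ), f (s + h) - f s < h * r) :
    ∀ t ∈ Icc a b, f t ≤ f a + c * (t - a) := by
  have hbound : ∀ s, HasDerivAt (fun t => f a + c * (t - a)) c s := fun s => by
    simpa using (((hasDerivAt_id s).sub_const a).const_mul c).const_add (f a)
  refine fun t ht => image_le_of_liminf_slope_right_le_deriv_boundary hf (by simp)
    (by fun_prop) (fun s _ => (hbound s).hasDerivWithinAt) (fun s hs r hr => ?_) ht
  have hmap : 𝓝[>] s = map (fun h => s + h) (𝓝[>] 0) := by simp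
  rw [hmap, frequently_map]
  refine ((hslope s hs r hr).and_eventually self_mem_nhdsWithin).mono fun h hh => ?_
  rw [slope_def_field, add_sub_cancel_left, div_lt_iff₀ hh.2, mul_comm]
  exact hh.1

variable {H : Type*} [NormedAddCommGroup H] [InnerProductSpace ℝ H]
  {T : ℝ → H →L[ℝ] H} {f : ℝ → H} {G : H → H} {τ : ℝ} {z w : ℝ → H}

/-- Dissipativity of an everywhere defined nonlinear operator: `z' = G(z)` does not increase the
distance of two solutions. -/
def IsDissipative (G : H → H) : Prop :=
  ∀ x y : H, ⟪G x - G y, x - y⟫_ℝ ≤ 0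

theorem IsGenerator.inner_nonpos {A : H →ₗ.[ℝ] H} (hA : IsGenerator T A)
    (hT : IsContractionSemigroup T) (x : A.domain) : ⟪A x, (x : H)⟫_ℝ ≤ 0 := by
  have hquot := ((hA _ _).1 (A.mem_graph x)).inner (𝕜 := ℝ) (tendsto_const_nhds (x := (x : H)))
  refine le_of_tendsto hquot ?_
  filter_upwards [self_mem_nhdsWithin] with t ht
  have hcontr : ⟪T t x, (x : H)⟫_ℝ ≤ ‖(x : H)‖ * ‖(x : H)‖ :=
    (real_inner_le_norm _ _).trans (by gcongr; exact hT.norm_apply_le t x)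
  rw [real_inner_smul_left, inner_sub_left, real_inner_self_eq_norm_mul_norm]
  exact mul_nonpos_of_nonneg_of_nonpos (inv_nonneg.2 (le_of_lt ht)) (sub_nonpos.2 hcontr)

namespace IsMildSolution

variable [CompleteSpace H]

theorem norm_le_of_inner_nonpos (hT : IsContractionSemigroup T) (hz : IsMildSolution T f τ z)
    (hf : ∀ t ∈ Ico 0 τ, ⟪f t, z t⟫_ℝ ≤ 0) {t : ℝ} (ht : t ∈ Icc 0 τ) : ‖z t‖ ≤ ‖z 0‖ := by
  suffices henergy : ‖z t‖ ^ 2 ≤ ‖z 0‖ ^ 2 + 0 * (t - 0) by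
    exact (sq_le_sq₀ (norm_nonneg _) (norm_nonneg _)).1 (by simpa using henergy)
  refine le_add_mul_of_frequently_right (f := fun t => ‖z t‖ ^ 2)
    (hz.continuous.norm.pow 2).continuousOn (fun s hs r hr => Eventually.frequently ?_) t ht
  have hTz : Tendsto (fun h => T h (z s)) (𝓝[>] 0) (𝓝 (z s)) := by
    simpa [ContinuousWithinAt, hT.map_zero] using (hT.continuous_apply continuous_id
      (continuous_const (y := z s))).continuousWithinAt (s := Ioi 0) (x := 0)
  have hzs : Tendsto (fun h => z (s + h)) (𝓝[>] 0) (𝓝 (z s)) := by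
    simpa [ContinuousWithinAt, Function.comp_def] using
      (hz.continuous.comp (continuous_const_add s)).continuousWithinAt (s := Ioi 0) (x := 0)
  have hlim := (hz.tendsto_expansion hT hs).inner (𝕜 := ℝ) (hzs.add hTz)
  have hneg : ⟪f s, z s + z s⟫_ℝ < r := by
    rw [inner_add_right]
    linarith [hf s hs]
  filter_upwards [hlim.eventually (gt_mem_nhds hneg), self_mem_nhdsWithin] with h hh hpos
  have hpos' : (0 : ℝ) < h := hpos
  rw [real_inner_smul_left, inv_mul_lt_iff₀ hpos'] at hh
  have hcontr : ‖T h (z s)‖ ^ 2 ≤ ‖z s‖ ^ 2 := by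
    gcongr
    exact hT.norm_apply_le h _
  have hdiff : ⟪z (s + h) - T h (z s), z (s + h) + T h (z s)⟫_ℝ =
      ‖z (s + h)‖ ^ 2 - ‖T h (z s)‖ ^ 2 := by
    rw [inner_sub_left, inner_add_right, inner_add_right, real_inner_self_eq_norm_sq,
      real_inner_self_eq_norm_sq, real_inner_comm (z (s + h))]
    ring
  linarith

theorem norm_sub_le (hT : IsContractionSemigroup T) (hG : IsDissipative G)
    (hz : IsMildSolution T (fun t => G (z t)) τ z) (hw : IsMildSolution T (fun t => G (w t)) τ w)
    {t : ℝ} (ht : t ∈ Icc 0 τ) : ‖z t - w t‖ ≤ ‖z 0 - w 0‖ :=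
  (hz.sub hT hw).norm_le_of_inner_nonpos hT (fun s _ => hG (z s) (w s)) ht

theorem eqOn (hT : IsContractionSemigroup T) (hG : IsDissipative G)
    (hz : IsMildSolution T (fun t => G (z t)) τ z) (hw : IsMildSolution T (fun t => G (w t)) τ w)
    (h0 : z 0 = w 0) : EqOn z w (Icc 0 τ) := fun t ht => by
  simpa [h0, sub_eq_zero] using hz.norm_sub_le hT hG hw ht

theorem norm_shift_sub_le (hT : IsContractionSemigroup T) (hG : IsDissipative G)
    (hz : IsMildSolution T (fun t => G (z t)) τ z) {a h : ℝ} (ha : 0 ≤ a) (hh : 0 ≤ h)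
    (hah : a + h ≤ τ) : ‖z (a + h) - z a‖ ≤ ‖z h - z 0‖ := by
  simpa [add_comm h a] using
    (hz.shift hT hh).norm_sub_le hT hG (hz.mono (by linarith)) (t := a) ⟨ha, by linarith⟩

theorem norm_shift_sub_le_mul (hT : IsContractionSemigroup T) (hG : IsDissipative G)
    {A : H →ₗ.[ℝ] H} (hA : IsGenerator T A) (hz : IsMildSolution T (fun t => G (z t)) τ z)
    {y : H} (hy : (z 0, y) ∈ A.graph) {a h : ℝ} (ha : 0 ≤ a) (hh : 0 ≤ h) (hah : a + h ≤ τ) :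
    ‖z (a + h) - z a‖ ≤ h * ‖y + G (z 0)‖ := by
  refine (hz.norm_shift_sub_le hT hG ha hh hah).trans ?_
  have hspeed := le_add_mul_of_frequently_right (f := fun s => ‖z s - z 0‖) (a := 0) (b := τ)
    (c := ‖y + G (z 0)‖) (hz.continuous.sub continuous_const).norm.continuousOn ?_ h
    ⟨hh, by linarith⟩
  · simpa [mul_comm] using hspeed
  intro s hs r hr
  have hder := hz.hasDerivWithinAt hT hA ⟨le_rfl, hs.1.trans_lt hs.2⟩ hy
  rw [hasDerivWithinAt_Ici_iff_tendsto] at hder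
  refine Eventually.frequently ?_
  filter_upwards [hder.norm.eventually (gt_mem_nhds hr), Ioo_mem_nhdsGT (sub_pos.2 hs.2)]
    with h hquot hh
  have hstep := hz.norm_shift_sub_le hT hG hs.1 hh.1.le (by linarith [hh.2])
  rw [zero_add, norm_smul, norm_inv, Real.norm_of_nonneg hh.1.le, inv_mul_lt_iff₀ hh.1] at hquot
  linarith [norm_sub_le_norm_sub_add_norm_sub (z (s + h)) (z s) (z 0)]

end IsMildSolution

end Dissipative

/-! ### Existence of mild solutions -/

section Existence

variable {H : Type*} [NormedAddCommGroup H] [NormedSpace ℝ H] {T : ℝ → H →L[ℝ] H} {G : H → H}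
  {δ : ℝ≥0}

/-- The Picard operator on `C([0, δ], H)`, whose fixed points are the mild solutions of
`z' = A z + G(z)`, `z 0 = y` on `[0, δ]`. -/
noncomputable def picardMap (hT : IsContractionSemigroup T) (hG : Continuous G) (y : H)
    (u : C(Icc (0 : ℝ) δ, H)) : C(Icc (0 : ℝ) δ, H) where
  toFun t := T t y + duhamel T (fun s => G (IccExtend δ.coe_nonneg u s)) t
  continuous_toFun := by
    have hduhamel := hT.continuous_duhamel (hG.comp (u.continuous.Icc_extend' (h := δ.coe_nonneg)))
    exact ((hT.continuous_apply continuous_id continuous_const).add hduhamel).comp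
      continuous_subtype_val

theorem picardMap_apply (hT : IsContractionSemigroup T) (hG : Continuous G) (y : H)
    (u : C(Icc (0 : ℝ) δ, H)) (t : Icc (0 : ℝ) δ) :
    picardMap hT hG y u t = T t y + duhamel T (fun s => G (IccExtend δ.coe_nonneg u s)) t :=
  rfl

theorem isMildSolution_of_picardMap_eq (hT : IsContractionSemigroup T) (hG : Continuous G) {y : H}
    {u : C(Icc (0 : ℝ) δ, H)} (hu : picardMap hT hG y u = u) :
    IccExtend δ.coe_nonneg u 0 = y ∧
      IsMildSolution T (fun t => G (IccExtend δ.coe_nonneg u t)) δ (IccExtend δ.coe_nonneg u) := by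
  have hcont : Continuous (IccExtend δ.coe_nonneg u) := u.continuous.Icc_extend'
  have hfix : ∀ t ∈ Icc (0 : ℝ) δ, IccExtend δ.coe_nonneg u t =
      T t y + duhamel T (fun s => G (IccExtend δ.coe_nonneg u s)) t := fun t ht => by
    rw [IccExtend_of_mem _ _ ht]
    nth_rw 1 [← hu]
    rfl
  have hinit : IccExtend δ.coe_nonneg u 0 = y := by
    simpa [duhamel, hT.map_zero] using hfix 0 ⟨le_rfl, δ.coe_nonneg⟩
  refine ⟨hinit, hG.comp hcont, hcont, fun t ht => ?_⟩
  rw [hinit]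
  exact hfix t ht

theorem dist_picardMap_le (hT : IsContractionSemigroup T) (hG : Continuous G) {y : H} {s : Set H}
    {K : ℝ≥0} (hK : LipschitzOnWith K G s) {u v : C(Icc (0 : ℝ) δ, H)} (hu : ∀ t, u t ∈ s)
    (hv : ∀ t, v t ∈ s) :
    dist (picardMap hT hG y u) (picardMap hT hG y v) ≤ (K * δ : ℝ≥0) * dist u v := by
  have hcont : ∀ u : C(Icc (0 : ℝ) δ, H), Continuous fun s => G (IccExtend δ.coe_nonneg u s) :=
    fun u => hG.comp u.continuous.Icc_extend'
  refine (ContinuousMap.dist_le (by positivity)).2 fun t => ?_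
  rw [picardMap_apply, picardMap_apply, dist_add_left, dist_eq_norm,
    ← hT.duhamel_sub (hcont u) (hcont v)]
  refine (hT.norm_duhamel_le (C := K * dist u v) t.2.1 fun r _ => ?_).trans ?_
  · rw [← dist_eq_norm]
    refine (hK.dist_le_mul _ (hu _) _ (hv _)).trans ?_
    gcongr
    exact ContinuousMap.dist_apply_le_dist _
  · have hle : K * dist u v * (t : ℝ) ≤ K * dist u v * δ := by
      gcongr
      exact t.2.2
    push_cast
    linarith

variable [CompleteSpace H]

theorem exists_isMildSolution_of_lipschitzOnWith (hT : IsContractionSemigroup T)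
    (hG : Continuous G) {x y : H} {ρ N : ℝ} {K : ℝ≥0} (hρ : 0 ≤ ρ)
    (hK : LipschitzOnWith K G (Metric.closedBall x ρ))
    (hN : ∀ v ∈ Metric.closedBall x ρ, ‖G v‖ ≤ N) (hKδ : K * δ < 1)
    (hself : ∀ t ∈ Icc (0 : ℝ) δ, ‖T t y - x‖ + N * δ ≤ ρ) :
    ∃ z : ℝ → H, z 0 = y ∧ IsMildSolution T (fun t => G (z t)) δ z := by
  let s : Set C(Icc (0 : ℝ) δ, H) := {u | ∀ t, u t ∈ Metric.closedBall x ρ}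
  have hclosed : IsClosed s := by
    simp only [s, ofPred_forall]
    exact isClosed_iInter fun t => Metric.isClosed_closedBall.preimage (by fun_prop)
  have hN₀ : 0 ≤ N := (norm_nonneg _).trans (hN x (Metric.mem_closedBall_self hρ))
  have hmaps : MapsTo (picardMap hT hG y) s s := fun u hu t => by
    rw [picardMap_apply, mem_closedBall_iff_norm, add_sub_right_comm]
    have hforcing := hT.norm_duhamel_le (f := fun s => G (IccExtend δ.coe_nonneg u s)) t.2.1
      fun r _ => hN _ (hu _)
    have hle : N * (t : ℝ) ≤ N * δ := by
      gcongr
      exact t.2.2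
    exact (norm_add_le _ _).trans (by linarith [hself t t.2])
  have hcontr : ContractingWith (K * δ) (hmaps.restrict (picardMap hT hG y) s s) :=
    ⟨hKδ, LipschitzWith.of_dist_le_mul fun u v => dist_picardMap_le hT hG hK u.2 v.2⟩
  have hx : ContinuousMap.const (Icc (0 : ℝ) δ) x ∈ s := fun _ => Metric.mem_closedBall_self hρ
  obtain ⟨u, -, hu, -⟩ :=
    hcontr.exists_fixedPoint' hclosed.isComplete hmaps hx (edist_ne_top _ _)
  exact ⟨_, isMildSolution_of_picardMap_eq hT hG hu⟩

/-- The time of existence is bounded below near each point, which is what makes it possible to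
extend a solution that has a limit. -/
theorem exists_pos_eventually_exists_isMildSolution (hT : IsContractionSemigroup T)
    (hG : LocallyLipschitz G) (x : H) :
    ∃ δ > 0, ∀ᶠ y in 𝓝 x, ∃ z : ℝ → H, z 0 = y ∧ IsMildSolution T (fun t => G (z t)) δ z := by
  obtain ⟨K, s, hs, hK⟩ := hG x
  obtain ⟨ρ, hρ, hρs⟩ := Metric.nhds_basis_closedBall.mem_iff.1 hs
  replace hK := hK.mono hρs
  have hN : ∀ v ∈ Metric.closedBall x ρ, ‖G v‖ ≤ ‖G x‖ + K * ρ := fun v hv => by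
    have hGv := hK.dist_le_mul v hv x (Metric.mem_closedBall_self hρ.le)
    have hle : (K : ℝ) * dist v x ≤ K * ρ := by
      gcongr
      exact hv
    rw [dist_eq_norm] at hGv
    linarith [norm_le_norm_add_norm_sub' (G v) (G x)]
  have horbit : ∀ᶠ p : ℝ × H in 𝓝 0 ×ˢ 𝓝 x, ‖T p.1 p.2 - x‖ < ρ / 2 := by
    have hcont : Continuous fun p : ℝ × H => ‖T p.1 p.2 - x‖ :=
      (hT.continuous_uncurry.sub continuous_const).norm
    rw [← nhds_prod_eq]
    exact hcont.continuousAt.eventually (gt_mem_nhds (by simpa [hT.map_zero] using hρ))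
  obtain ⟨p, hp, q, hq, hpq⟩ := eventually_prod_iff.1 horbit
  obtain ⟨ε, hε, hball⟩ := Metric.eventually_nhds_iff.1 hp
  have hsmall : ∀ᶠ δ : ℝ≥0 in 𝓝[>] 0, K * δ < 1 ∧ (‖G x‖ + K * ρ) * δ < ρ / 2 ∧ (δ : ℝ) < ε := by
    have hcont₁ : Continuous fun δ : ℝ≥0 => K * δ := by fun_prop
    have hcont₂ : Continuous fun δ : ℝ≥0 => (‖G x‖ + K * ρ) * δ := by fun_prop
    refine nhdsWithin_le_nhds (Eventually.and ?_ (Eventually.and ?_ ?_))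
    · exact hcont₁.continuousAt.eventually (gt_mem_nhds (by simp))
    · exact hcont₂.continuousAt.eventually (gt_mem_nhds (by simpa using hρ))
    · exact NNReal.continuous_coe.continuousAt.eventually (gt_mem_nhds (by simpa using hε))
  obtain ⟨δ, ⟨hKδ, hNδ, hδε⟩, hδ⟩ := (hsmall.and self_mem_nhdsWithin).exists
  refine ⟨δ, hδ, hq.mono fun y hy => ?_⟩
  refine exists_isMildSolution_of_lipschitzOnWith hT hG.continuous hρ.le hK hN hKδ fun t ht => ?_
  have ht' : dist t 0 < ε := by
    rw [Real.dist_0_eq_abs, abs_of_nonneg ht.1]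
    exact ht.2.trans_lt hδε
  linarith [hpq (hball ht') hy]

theorem IsMildSolution.exists_append (hT : IsContractionSemigroup T) (hG : Continuous G)
    {z w : ℝ → H} {τ δ : ℝ} (hτ : 0 ≤ τ) (hz : IsMildSolution T (fun t => G (z t)) τ z)
    (hw : IsMildSolution T (fun t => G (w t)) δ w) (hzw : w 0 = z τ) :
    ∃ v : ℝ → H, v 0 = z 0 ∧ IsMildSolution T (fun t => G (v t)) (τ + δ) v := by
  let v : ℝ → H := fun t => if t ≤ τ then z t else w (t - τ)
  have hv : Continuous v := by
    refine hz.continuous.if_le (hw.continuous.comp (by fun_prop)) continuous_id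
      continuous_const fun t ht => ?_
    rw [ht, sub_self, hzw]
  have hleft : EqOn z v (Icc 0 τ) := fun t ht => (if_pos ht.2).symm
  have hright : EqOn w (fun t => v (τ + t)) (Icc 0 δ) := fun t ht => by
    rcases ht.1.eq_or_lt with rfl | hpos
    · simp [v, hzw]
    · simp [v, hpos]
  refine ⟨v, (hleft ⟨le_rfl, hτ⟩).symm, IsMildSolution.append hT hτ ?_ ?_⟩
  · exact hz.congr (hG.comp hv) hv (fun t ht => congrArg G (hleft ht)) hleft
  · exact hw.congr (hG.comp (hv.comp (continuous_const_add τ))) (hv.comp (continuous_const_add τ))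
      (fun t ht => congrArg G (hright ht)) hright

end Existence

section GlobalExistence

variable {H : Type*} [NormedAddCommGroup H] [InnerProductSpace ℝ H] [CompleteSpace H]
  {T : ℝ → H →L[ℝ] H} {G : H → H} {x : H} {τ : ℝ}

theorem exists_gluing_isMildSolution (hT : IsContractionSemigroup T) (hG : IsDissipative G)
    {J : Set ℝ} (hJ : ∀ τ ∈ J, Icc 0 τ ⊆ J)
    (hex : ∀ τ ∈ J, ∃ z : ℝ → H, z 0 = x ∧ IsMildSolution T (fun t => G (z t)) τ z) :
    ∃ u : ℝ → H, ∀ τ ∈ J, ∃ z : ℝ → H,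
      z 0 = x ∧ IsMildSolution T (fun t => G (z t)) τ z ∧ EqOn u z (Icc 0 τ) := by
  choose! Z hZ₀ hZ using hex
  refine ⟨fun t => Z t t, fun τ hτ => ⟨Z τ, hZ₀ τ hτ, hZ τ hτ, fun t ht => ?_⟩⟩
  have htJ := hJ τ hτ ht
  exact (hZ t htJ).eqOn hT hG ((hZ τ hτ).mono ht.2) ((hZ₀ t htJ).trans (hZ₀ τ hτ).symm)
    ⟨ht.1, le_rfl⟩

/-- The modulus of continuity at time `0` is a uniform modulus of continuity. -/
theorem exists_tendsto_nhdsLT_of_gluing (hT : IsContractionSemigroup T) (hG : IsDissipative G)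
    (hτ : 0 < τ) {u : ℝ → H} (hu : ∀ t ∈ Ico 0 τ, ∃ z : ℝ → H,
      z 0 = x ∧ IsMildSolution T (fun t => G (z t)) t z ∧ EqOn u z (Icc 0 t)) :
    ∃ y, Tendsto u (𝓝[<] τ) (𝓝 y) := by
  have hshift : ∀ s t, 0 ≤ s → s ≤ t → t < τ → dist (u s) (u t) ≤ dist (u (t - s)) (u 0) := by
    intro s t hs hst htτ
    obtain ⟨z, -, hz, huz⟩ := hu t ⟨hs.trans hst, htτ⟩
    have h := hz.norm_shift_sub_le hT hG hs (sub_nonneg.2 hst) (by linarith)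
    rwa [add_sub_cancel, ← huz ⟨hs, hst⟩, ← huz ⟨hs.trans hst, le_rfl⟩,
      ← huz ⟨sub_nonneg.2 hst, by linarith⟩, ← huz ⟨le_rfl, hs.trans hst⟩, ← dist_eq_norm,
      ← dist_eq_norm, dist_comm] at h
  have hzero : ContinuousWithinAt u (Icc 0 (τ / 2)) 0 := by
    obtain ⟨z, -, hz, huz⟩ := hu (τ / 2) ⟨by positivity, by linarith⟩
    exact hz.continuous.continuousWithinAt.congr huz (huz ⟨le_rfl, by positivity⟩)
  refine cauchy_map_iff_exists_tendsto.1 (Metric.cauchy_iff.2 ⟨inferInstance, fun ε hε => ?_⟩)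
  obtain ⟨δ, hδ, hclose⟩ := Metric.continuousWithinAt_iff.1 hzero ε hε
  refine ⟨u '' Ioo (max (τ / 2) (τ - δ)) τ,
    image_mem_map (Ioo_mem_nhdsLT (max_lt (by linarith) (by linarith))), ?_⟩
  rintro _ ⟨s, ⟨hs, hsτ⟩, rfl⟩ _ ⟨t, ⟨ht, htτ⟩, rfl⟩
  rw [max_lt_iff] at hs ht
  wlog hst : s ≤ t generalizing s t
  · rw [dist_comm]
    exact this t ht htτ s hs hsτ (le_of_not_ge hst)
  refine (hshift s t (by linarith) hst htτ).trans_lt (hclose ⟨by linarith, by linarith⟩ ?_)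
  rw [Real.dist_0_eq_abs, abs_of_nonneg (by linarith)]
  linarith

theorem exists_isMildSolution_gt (hT : IsContractionSemigroup T) (hG : LocallyLipschitz G)
    (hdiss : IsDissipative G) (hτ : 0 < τ)
    (hex : ∀ t ∈ Ico 0 τ, ∃ z : ℝ → H, z 0 = x ∧ IsMildSolution T (fun t => G (z t)) t z) :
    ∃ τ' > τ, ∃ z : ℝ → H, z 0 = x ∧ IsMildSolution T (fun t => G (z t)) τ' z := by
  obtain ⟨u, hu⟩ := exists_gluing_isMildSolution hT hdiss (J := Ico 0 τ)
    (fun t ht s hs => ⟨hs.1, hs.2.trans_lt ht.2⟩) hex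
  obtain ⟨y, hy⟩ := exists_tendsto_nhdsLT_of_gluing hT hdiss hτ hu
  obtain ⟨δ, hδ, hlocal⟩ := exists_pos_eventually_exists_isMildSolution hT hG y
  obtain ⟨t, ⟨w, hw₀, hw⟩, ht⟩ := ((hy.eventually hlocal).and
    (Ioo_mem_nhdsLT (max_lt hτ (sub_lt_self τ hδ)))).exists
  have ht' := max_lt_iff.1 ht.1
  obtain ⟨z, hz₀, hz, huz⟩ := hu t ⟨ht'.1.le, ht.2⟩
  obtain ⟨v, hv₀, hv⟩ := hz.exists_append hT hG.continuous ht'.1.le hw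
    (hw₀.trans (huz ⟨ht'.1.le, le_rfl⟩))
  exact ⟨t + δ, by linarith, v, hv₀.trans hz₀, hv⟩

theorem exists_isMildSolution (hT : IsContractionSemigroup T) (hG : LocallyLipschitz G)
    (hdiss : IsDissipative G) (x : H) (τ : ℝ) :
    ∃ z : ℝ → H, z 0 = x ∧ IsMildSolution T (fun t => G (z t)) τ z := by
  let J : Set ℝ := {τ | ∃ z : ℝ → H, z 0 = x ∧ IsMildSolution T (fun t => G (z t)) τ z}
  have hlower : ∀ τ ∈ J, ∀ t ≤ τ, t ∈ J := fun τ ⟨z, hz₀, hz⟩ t ht => ⟨z, hz₀, hz.mono ht⟩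
  obtain ⟨δ, hδ, hlocal⟩ := exists_pos_eventually_exists_isMildSolution hT hG x
  have hδJ : δ ∈ J := hlocal.self_of_nhds
  suffices hunbounded : ¬ BddAbove J by
    obtain ⟨t, ht, hlt⟩ := not_bddAbove_iff.1 hunbounded τ
    exact hlower t ht τ hlt.le
  intro hbdd
  obtain ⟨τ', hτ', hmem⟩ := exists_isMildSolution_gt hT hG hdiss
    (hδ.trans_le (le_csSup hbdd hδJ)) fun t ht => by
      obtain ⟨s, hs, hts⟩ := exists_lt_of_lt_csSup ⟨δ, hδJ⟩ ht.2
      exact hlower s hs t hts.le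
  exact hτ'.not_ge (le_csSup hbdd hmem)

theorem exists_forall_isMildSolution (hT : IsContractionSemigroup T) (hG : LocallyLipschitz G)
    (hdiss : IsDissipative G) (x : H) :
    ∃ z : ℝ → H, z 0 = x ∧ ∀ τ, IsMildSolution T (fun t => G (z t)) τ z := by
  obtain ⟨u, hu⟩ := exists_gluing_isMildSolution hT hdiss (J := univ) (fun _ _ => subset_univ _)
    fun τ _ => exists_isMildSolution hT hG hdiss x τ
  have hmax : EqOn u (fun t => u (max t 0)) (Ici 0) := fun t ht => by
    simp only [max_eq_left (mem_Ici.1 ht)]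
  have hcont : Continuous fun t => u (max t 0) := by
    refine continuous_iff_continuousAt.2 fun t => ?_
    obtain ⟨z, -, hz, huz⟩ := hu (|t| + 1) (mem_univ _)
    have hzmax : Continuous fun t => z (max t 0) := hz.continuous.comp (by fun_prop)
    refine hzmax.continuousAt.congr ?_
    filter_upwards [Iio_mem_nhds ((le_abs_self t).trans_lt (lt_add_one |t|))] with s hs
    exact (huz ⟨le_max_right s 0, max_le (le_of_lt hs) (by positivity)⟩).symm
  refine ⟨fun t => u (max t 0), ?_, fun τ => ?_⟩
  · obtain ⟨z, hz₀, -, huz⟩ := hu 0 (mem_univ _)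
    simp only [max_self, huz ⟨le_rfl, le_rfl⟩, hz₀]
  · obtain ⟨z, -, hz, huz⟩ := hu τ (mem_univ _)
    have hzu : EqOn z (fun t => u (max t 0)) (Icc 0 τ) := fun t ht =>
      (huz ht).symm.trans (hmax ht.1)
    exact hz.congr (hG.continuous.comp hcont) hcont (fun t ht => congrArg G (hzu ht)) hzu

end GlobalExistence

/-! ### Strong solutions -/

section BoundedQuotients

variable {H : Type*} [NormedAddCommGroup H] [InnerProductSpace ℝ H] [CompleteSpace H]

theorem exists_ultrafilter_tendsto_inner {X : Type*} {l : Filter X} [NeBot l] {a : X → H} {C : ℝ}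
    (ha : ∀ᶠ x in l, ‖a x‖ ≤ C) :
    ∃ (u : Ultrafilter X) (y : H), ↑u ≤ l ∧
      ∀ e : H, Tendsto (fun x => ⟪a x, e⟫_ℝ) u (𝓝 ⟪y, e⟫_ℝ) := by
  let D := InnerProductSpace.toDual ℝ H
  let u := Ultrafilter.of l
  have hu : ↑u ≤ l := Ultrafilter.of_le l
  let F : X → WeakDual ℝ H := fun x => StrongDual.toWeakDual (D (a x))
  have hball : ∀ᶠ x in (u : Filter X),
      F x ∈ WeakDual.toStrongDual ⁻¹' Metric.closedBall 0 C := by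
    filter_upwards [hu ha] with x hx
    simpa [F] using hx
  obtain ⟨f, -, hf⟩ := (WeakDual.isCompact_closedBall (𝕜 := ℝ) (E := H) 0 C).ultrafilter_le_nhds
    (u.map F) (le_principal_iff.2 hball)
  refine ⟨u, D.symm (WeakDual.toStrongDual f), hu, fun e => ?_⟩
  rw [InnerProductSpace.toDual_symm_apply]
  exact ((WeakDual.eval_continuous e).tendsto f).comp hf

variable {T : ℝ → H →L[ℝ] H}

/-- Both sides have weak right derivative `T t y`, along an ultrafilter, and agree at `t = 0`. -/
theorem IsContractionSemigroup.sub_eq_integral_of_tendsto_inner (hT : IsContractionSemigroup T)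
    {x y : H} {u : Ultrafilter ℝ} (hu : ↑u ≤ 𝓝[>] (0 : ℝ))
    (hy : ∀ e : H, Tendsto (fun h : ℝ => ⟪h⁻¹ • (T h x - x), e⟫_ℝ) u (𝓝 ⟪y, e⟫_ℝ)) {t : ℝ}
    (ht : 0 ≤ t) : T t x - x = ∫ s in (0 : ℝ)..t, T s y := by
  have horbit : ∀ v, Continuous fun s => T s v := fun v =>
    hT.continuous_apply continuous_id continuous_const
  let I : ℝ → H := fun t => ∫ s in (0 : ℝ)..t, T s y
  have hI : ∀ t, HasDerivAt I (T t y) t := fun t =>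
    ((horbit y).integral_hasStrictDerivAt 0 t).hasDerivAt
  have hIcont : Continuous I := continuous_iff_continuousAt.2 fun t => (hI t).continuousAt
  suffices hweak : ∀ e : H, ⟪T t x - x - I t, e⟫_ℝ ≤ 0 from
    sub_eq_zero.1 (real_inner_self_nonpos.1 (hweak _))
  intro e
  have hgrowth := le_add_mul_of_frequently_right (f := fun t => ⟪T t x - x - I t, e⟫_ℝ) (a := 0)
    (b := t) (c := 0) ((((horbit x).sub continuous_const).sub hIcont).inner
      continuous_const).continuousOn (fun s hs r hr => ?_) t ⟨ht, le_rfl⟩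
  · simpa [I, hT.map_zero] using hgrowth
  have hquot := (hy ((T s).adjoint e)).sub
    (((hasDerivWithinAt_Ici_iff_tendsto.1 (hI s).hasDerivWithinAt).mono_left hu).inner
      (tendsto_const_nhds (x := e)))
  simp only [ContinuousLinearMap.adjoint_inner_right, sub_self] at hquot
  refine Frequently.filter_mono (Eventually.frequently ?_) hu
  filter_upwards [hquot.eventually (gt_mem_nhds hr), hu self_mem_nhdsWithin] with h hlt hh
  have hh' : (0 : ℝ) < h := hh
  rw [map_smul, real_inner_smul_left, real_inner_smul_left, ← mul_sub, inv_mul_lt_iff₀ hh'] at hlt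
  refine lt_of_eq_of_lt ?_ hlt
  rw [hT.map_add s h hs.1 hh'.le, ContinuousLinearMap.comp_apply, ← inner_sub_left,
    ← inner_sub_left, map_sub]
  congr 1
  abel

theorem IsGenerator.exists_mem_graph_of_bounded (hT : IsContractionSemigroup T) {A : H →ₗ.[ℝ] H}
    (hA : IsGenerator T A) {x : H} {C : ℝ}
    (hx : ∀ᶠ h in 𝓝[>] (0 : ℝ), ‖h⁻¹ • (T h x - x)‖ ≤ C) : ∃ y, (x, y) ∈ A.graph := by
  obtain ⟨u, y, hu, hy⟩ := exists_ultrafilter_tendsto_inner hx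
  have horbit : Continuous fun s => T s y := hT.continuous_apply continuous_id continuous_const
  have hder := (horbit.integral_hasStrictDerivAt 0 0).hasDerivAt.hasDerivWithinAt (s := Ici 0)
  rw [hasDerivWithinAt_Ici_iff_tendsto, hT.map_zero, intervalIntegral.integral_same] at hder
  refine ⟨y, (hA x y).2 (hder.congr' ?_)⟩
  filter_upwards [self_mem_nhdsWithin] with h hh
  rw [zero_add, sub_zero, hT.sub_eq_integral_of_tendsto_inner hu hy (le_of_lt hh)]

end BoundedQuotients

section RightSolutions

variable {H : Type*} [NormedAddCommGroup H] [NormedSpace ℝ H]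

theorem ae_hasDerivAt_of_hasDerivWithinAt_Ici {E : Type*} [NormedAddCommGroup E] [NormedSpace ℝ E]
    [CompleteSpace E] {z g : ℝ → E} {C : ℝ} (hz : ContinuousOn z (Ici 0))
    (hder : ∀ t, 0 ≤ t → HasDerivWithinAt z (g t) (Ici t) t) (hg : ∀ t, 0 ≤ t → ‖g t‖ ≤ C) :
    ∀ᵐ t : ℝ, 0 < t → HasDerivAt z (g t) t := by
  have hint : ∀ τ, 0 ≤ τ → IntervalIntegrable g volume 0 τ := by
    intro τ hτ
    have hderiv : EqOn (fun t => derivWithin z (Ici t) t) g (Ioc 0 τ) := fun t ht =>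
      (hder t ht.1.le).derivWithin (uniqueDiffWithinAt_Ici t)
    rw [intervalIntegrable_iff_integrableOn_Ioc_of_le hτ]
    refine IntegrableOn.congr_fun (Measure.integrableOn_of_bounded (M := C) (by simp)
      (aestronglyMeasurable_derivWithin_Ici z _) ?_) hderiv measurableSet_Ioc
    filter_upwards [ae_restrict_mem measurableSet_Ioc] with t ht
    exact (congrArg norm (hderiv ht)).trans_le (hg t ht.1.le)
  have hftc : ∀ τ, 0 ≤ τ → z τ = z 0 + ∫ s in (0 : ℝ)..τ, g s := fun τ hτ => by
    rw [intervalIntegral.integral_eq_sub_of_hasDeriv_right_of_le hτ (hz.mono Icc_subset_Ici_self)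
      (fun t ht => (hder t ht.1.le).mono Ioi_subset_Ici_self) (hint τ hτ), add_sub_cancel]
  have hae : ∀ n : ℕ, ∀ᵐ t : ℝ, t ∈ Ioo (0 : ℝ) n → HasDerivAt z (g t) t := by
    intro n
    filter_upwards [(hint n n.cast_nonneg).ae_hasDerivAt_integral] with t ht htn
    have hmem : t ∈ uIcc (0 : ℝ) n := by
      rw [uIcc_of_le n.cast_nonneg]
      exact Ioo_subset_Icc_self htn
    refine ((ht hmem 0 left_mem_uIcc).const_add (z 0)).congr_of_eventuallyEq ?_
    filter_upwards [Ioi_mem_nhds htn.1] with s hs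
    exact hftc s (le_of_lt hs)
  filter_upwards [ae_all_iff.2 hae] with t ht hpos
  obtain ⟨n, hn⟩ := exists_nat_gt t
  exact ht n ⟨hpos, hn⟩

theorem lipschitzOnWith_of_hasDerivWithinAt_Ici {E : Type*} [NormedAddCommGroup E]
    [NormedSpace ℝ E] {z g : ℝ → E} {C : ℝ} (hz : ContinuousOn z (Ici 0))
    (hder : ∀ t, 0 ≤ t → HasDerivWithinAt z (g t) (Ici t) t) (hg : ∀ t, 0 ≤ t → ‖g t‖ ≤ C) :
    LipschitzOnWith C.toNNReal z (Ici 0) := by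
  refine LipschitzOnWith.of_dist_le' fun s hs t ht => ?_
  wlog hst : s ≤ t generalizing s t
  · rw [dist_comm, dist_comm s]
    exact this t ht s hs (le_of_not_ge hst)
  rw [dist_comm, dist_comm s, dist_eq_norm, Real.dist_eq, abs_of_nonneg (sub_nonneg.2 hst)]
  exact norm_image_sub_le_of_norm_deriv_right_le_segment
    (hz.mono fun r hr => le_trans hs hr.1) (fun r hr => hder r (le_trans hs hr.1))
    (fun r hr => hg r (le_trans hs hr.1)) t ⟨hst, le_rfl⟩

/-- `z` is a solution of `z' = F(z)` on `[0, ∞)` in the right-sided sense of Kato: at every time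
`t ≥ 0` it is in the domain of `F` and has right derivative `F(z(t))`. Unlike the derivative of a
strong solution, this makes sense at every time, in particular at those of a time shift. -/
structure IsRightSolution {D : Submodule ℝ H} (F : D → H) (z : ℝ → H) : Prop where
  continuousOn : ContinuousOn z (Ici 0)
  ode : ∀ t, 0 ≤ t → ∃ ht : z t ∈ D, HasDerivWithinAt z (F ⟨z t, ht⟩) (Ici t) t

namespace IsRightSolution

variable {D : Submodule ℝ H} {F : D → H} {z : ℝ → H}

theorem mem (hz : IsRightSolution F z) {t : ℝ} (ht : 0 ≤ t) : z t ∈ D :=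
  (hz.ode t ht).1

theorem hasDerivWithinAt (hz : IsRightSolution F z) {t : ℝ} (ht : 0 ≤ t) :
    HasDerivWithinAt z (F ⟨z t, hz.mem ht⟩) (Ici t) t :=
  (hz.ode t ht).2

theorem shift (hz : IsRightSolution F z) {a : ℝ} (ha : 0 ≤ a) :
    IsRightSolution F fun t => z (a + t) := by
  refine ⟨hz.continuousOn.comp (by fun_prop) fun t ht => add_nonneg ha ht, fun t ht => ?_⟩
  refine ⟨hz.mem (add_nonneg ha ht), ?_⟩
  have hder := hz.hasDerivWithinAt (add_nonneg ha ht)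
  rw [hasDerivWithinAt_Ici_iff_tendsto] at hder ⊢
  simpa only [add_assoc] using hder

end IsRightSolution

end RightSolutions

section StrongSolutions

variable {H : Type*} [NormedAddCommGroup H] [InnerProductSpace ℝ H] [CompleteSpace H]
  {T : ℝ → H →L[ℝ] H} {A : H →ₗ.[ℝ] H} {G : H → H}

theorem IsRightSolution.isStrongSolution {D : Submodule ℝ H} {F : D → H} {z : ℝ → H}
    (hz : IsRightSolution F z) {C : ℝ} (hF : ∀ t (ht : 0 ≤ t), ‖F ⟨z t, hz.mem ht⟩‖ ≤ C) :
    IsStrongSolution F (z 0) z := by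
  obtain ⟨g, hg⟩ : ∃ g : ℝ → H, ∀ t (ht : 0 ≤ t), g t = F ⟨z t, hz.mem ht⟩ :=
    ⟨fun t => if ht : 0 ≤ t then F ⟨z t, hz.mem ht⟩ else 0, fun t ht => dif_pos ht⟩
  have hder : ∀ t, 0 ≤ t → HasDerivWithinAt z (g t) (Ici t) t := fun t ht => by
    rw [hg t ht]
    exact hz.hasDerivWithinAt ht
  have hgC : ∀ t, 0 ≤ t → ‖g t‖ ≤ C := fun t ht => by
    rw [hg t ht]
    exact hF t ht
  have hlip := lipschitzOnWith_of_hasDerivWithinAt_Ici hz.continuousOn hder hgC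
  refine ⟨rfl, fun τ hτ => ⟨?_, ?_⟩⟩
  · refine LipschitzOnWith.absolutelyContinuousOnInterval (hlip.mono ?_)
    rw [uIcc_of_le hτ.le]
    exact Icc_subset_Ici_self
  · filter_upwards [ae_hasDerivAt_of_hasDerivWithinAt_Ici hz.continuousOn hder hgC]
      with t ht htτ
    refine ⟨hz.mem htτ.1.le, ?_⟩
    rw [← hg t htτ.1.le]
    exact ht htτ.1

theorem IsMildSolution.exists_mem_graph (hT : IsContractionSemigroup T) (hA : IsGenerator T A)
    (hG : IsDissipative G) {τ : ℝ} {z : ℝ → H} (hz : IsMildSolution T (fun t => G (z t)) τ z)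
    {y : H} (hy : (z 0, y) ∈ A.graph) {t : ℝ} (ht : t ∈ Ico 0 τ) : ∃ y, (z t, y) ∈ A.graph := by
  have hforcing := (hz.tendsto_expansion hT ht).norm.eventually (gt_mem_nhds (lt_add_one _))
  refine hA.exists_mem_graph_of_bounded hT (C := ‖y + G (z 0)‖ + (‖G (z t)‖ + 1)) ?_
  filter_upwards [hforcing, Ioo_mem_nhdsGT (sub_pos.2 ht.2)] with h hforcing hh
  have hspeed := hz.norm_shift_sub_le_mul hT hG hA hy ht.1 hh.1.le (by linarith [hh.2])
  rw [← inv_mul_le_iff₀ hh.1] at hspeed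
  calc ‖h⁻¹ • (T h (z t) - z t)‖
      = ‖h⁻¹ • (z (t + h) - z t) - h⁻¹ • (z (t + h) - T h (z t))‖ := by
        rw [← smul_sub, sub_sub_sub_cancel_left]
    _ ≤ ‖h⁻¹ • (z (t + h) - z t)‖ + ‖h⁻¹ • (z (t + h) - T h (z t))‖ := _root_.norm_sub_le _ _
    _ ≤ ‖y + G (z 0)‖ + (‖G (z t)‖ + 1) := by
        refine add_le_add ?_ hforcing.le
        rwa [norm_smul, norm_inv, Real.norm_of_nonneg hh.1.le]

theorem exists_isRightSolution (hT : IsContractionSemigroup T) (hA : IsGenerator T A)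
    (hG : LocallyLipschitz G) (hdiss : IsDissipative G) (x : A.domain) :
    ∃ (z : ℝ → H) (hz : IsRightSolution (fun y : A.domain => A y + G y) z), z 0 = x ∧
      ∀ t (ht : 0 ≤ t), ‖A ⟨z t, hz.mem ht⟩ + G (z t)‖ ≤ ‖A x + G x‖ := by
  obtain ⟨z, hz0, hz⟩ := exists_forall_isMildSolution hT hG hdiss x
  have hx : (z 0, A x) ∈ A.graph := hz0 ▸ A.mem_graph x
  have hsol : IsRightSolution (fun y : A.domain => A y + G y) z := by
    refine ⟨(hz 0).continuous.continuousOn, fun t ht => ?_⟩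
    have htτ : t ∈ Ico 0 (t + 1) := ⟨ht, lt_add_one t⟩
    obtain ⟨y, hy⟩ := (hz (t + 1)).exists_mem_graph hT hA hdiss hx htτ
    exact ⟨A.mem_domain_of_mem_graph hy,
      (hz (t + 1)).hasDerivWithinAt hT hA htτ (A.mem_graph ⟨z t, A.mem_domain_of_mem_graph hy⟩)⟩
  refine ⟨z, hsol, hz0, fun t ht => ?_⟩
  refine le_of_tendsto (hasDerivWithinAt_Ici_iff_tendsto.1 (hsol.hasDerivWithinAt ht)).norm ?_
  filter_upwards [self_mem_nhdsWithin] with h hh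
  have hh' : (0 : ℝ) < h := hh
  have hspeed := (hz (t + h)).norm_shift_sub_le_mul hT hdiss hA hx ht hh'.le le_rfl
  rw [norm_smul, norm_inv, Real.norm_of_nonneg hh'.le, inv_mul_le_iff₀ hh']
  rwa [hz0] at hspeed

end StrongSolutions

section Uniqueness

theorem absolutelyContinuousOnInterval_comp_of_lipschitzOnWith {X Y : Type*} [PseudoMetricSpace X]
    [PseudoMetricSpace Y] {z : ℝ → X} {V : X → Y} {a b : ℝ} {K : ℝ≥0}
    (hV : LipschitzOnWith K V (z '' uIcc a b)) (hz : AbsolutelyContinuousOnInterval z a b) :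
    AbsolutelyContinuousOnInterval (fun t => V (z t)) a b := by
  rw [absolutelyContinuousOnInterval_iff] at hz ⊢
  intro ε hε
  obtain ⟨δ, hδ, h⟩ := hz (ε / (K + 1)) (by positivity)
  refine ⟨δ, hδ, fun I hI hlen => ?_⟩
  calc ∑ i ∈ Finset.range I.1, dist (V (z (I.2 i).1)) (V (z (I.2 i).2))
      ≤ ∑ i ∈ Finset.range I.1, K * dist (z (I.2 i).1) (z (I.2 i).2) :=
        Finset.sum_le_sum fun i hi => hV.dist_le_mul _ (mem_image_of_mem z (hI.1 i hi).1) _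
          (mem_image_of_mem z (hI.1 i hi).2)
    _ = K * ∑ i ∈ Finset.range I.1, dist (z (I.2 i).1) (z (I.2 i).2) := by rw [Finset.mul_sum]
    _ ≤ K * (ε / (K + 1)) := by
        gcongr
        exact (h I hI hlen).le
    _ < (K + 1) * (ε / (K + 1)) := by
        gcongr
        exact lt_add_one _
    _ = ε := by field_simp

theorem absolutelyContinuousOnInterval_comp_of_contDiff {E F : Type*} [NormedAddCommGroup E]
    [NormedSpace ℝ E] [NormedAddCommGroup F] [NormedSpace ℝ F] {z : ℝ → E} {V : E → F} {a b : ℝ}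
    (hV : ContDiff ℝ 1 V) (hz : AbsolutelyContinuousOnInterval z a b) :
    AbsolutelyContinuousOnInterval (fun t => V (z t)) a b := by
  obtain ⟨K, hK⟩ := hV.locallyLipschitz.locallyLipschitzOn.exists_lipschitzOnWith_of_compact
    (isCompact_uIcc.image_of_continuousOn hz.continuousOn)
  exact absolutelyContinuousOnInterval_comp_of_lipschitzOnWith hK hz

theorem le_of_ae_hasDerivAt_nonpos {φ : ℝ → ℝ} {a b : ℝ} (hab : a ≤ b)
    (hφ : AbsolutelyContinuousOnInterval φ a b)
    (hder : ∀ᵐ t : ℝ, t ∈ Ioo a b → ∃ d ≤ 0, HasDerivAt φ d t) : φ b ≤ φ a := by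
  rw [← sub_nonpos, ← hφ.integral_deriv_eq_sub, intervalIntegral.integral_of_le hab,
    integral_Ioc_eq_integral_Ioo]
  refine setIntegral_nonpos_of_ae_restrict ?_
  filter_upwards [ae_restrict_mem measurableSet_Ioo, ae_restrict_of_ae hder] with t ht h
  obtain ⟨d, hd, hd'⟩ := h ht
  rw [hd'.deriv]
  exact hd

variable {H : Type*} [NormedAddCommGroup H] [InnerProductSpace ℝ H] {D : Submodule ℝ H}
  {F : D → H} {z w : ℝ → H}

theorem IsStrongSolutionOn.norm_sub_le (hF : ∀ x y : D, ⟪F x - F y, (x : H) - y⟫_ℝ ≤ 0) {τ : ℝ}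
    (hτ : 0 ≤ τ) (hz : IsStrongSolutionOn F τ z) (hw : IsStrongSolutionOn F τ w) :
    ‖z τ - w τ‖ ≤ ‖z 0 - w 0‖ := by
  have hac : AbsolutelyContinuousOnInterval (fun t => ‖z t - w t‖ ^ 2) 0 τ :=
    absolutelyContinuousOnInterval_comp_of_contDiff (V := fun x : H => ‖x‖ ^ 2) (contDiff_norm_sq ℝ)
      (hz.absCont.sub hw.absCont)
  refine (sq_le_sq₀ (norm_nonneg _) (norm_nonneg _)).1 (le_of_ae_hasDerivAt_nonpos hτ hac ?_)
  filter_upwards [hz.ode, hw.ode] with t hzt hwt ht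
  obtain ⟨hzD, hz'⟩ := hzt ht
  obtain ⟨hwD, hw'⟩ := hwt ht
  refine ⟨_, ?_, (hz'.sub hw').norm_sq⟩
  rw [real_inner_comm]
  exact mul_nonpos_of_nonneg_of_nonpos zero_le_two (hF ⟨z t, hzD⟩ ⟨w t, hwD⟩)

theorem IsStrongSolution.eqOn (hF : ∀ x y : D, ⟪F x - F y, (x : H) - y⟫_ℝ ≤ 0) {z₀ : H}
    (hz : IsStrongSolution F z₀ z) (hw : IsStrongSolution F z₀ w) : EqOn z w (Ici 0) := by
  intro t ht
  rcases (mem_Ici.1 ht).eq_or_lt with rfl | hpos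
  · rw [hz.init, hw.init]
  · simpa [hz.init, hw.init, sub_eq_zero] using
      (hz.sol t hpos).norm_sub_le hF hpos.le (hw.sol t hpos)

end Uniqueness

/-! ### Decay of right-differentiable functions -/

section Comparison

theorem le_of_hasDerivWithinAt_Ici_nonpos {f : ℝ → ℝ} {a b : ℝ} (hab : a ≤ b)
    (hf : ContinuousOn f (Icc a b))
    (hder : ∀ t ∈ Ico a b, ∃ d ≤ 0, HasDerivWithinAt f d (Ici t) t) : f b ≤ f a := by
  choose! f' hf' hder using hder
  exact image_le_of_deriv_right_le_deriv_boundary hf hder (B := fun _ => f a) (B' := fun _ => 0)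
    le_rfl continuousOn_const (fun _ _ => hasDerivWithinAt_const _ _ _) hf' ⟨hab, le_rfl⟩

theorem le_exp_of_contraction {f : ℝ → ℝ} {q τ : ℝ} (hq : 0 < q) (hq1 : q < 1) (hτ : 0 < τ)
    (hf0 : 0 ≤ f 0) (hanti : AntitoneOn f (Ici 0)) (hstep : ∀ s, 0 ≤ s → f (s + τ) ≤ q * f s)
    {t : ℝ} (ht : 0 ≤ t) : f t ≤ q⁻¹ * Real.exp (-(-Real.log q / τ) * t) * f 0 := by
  have hpow : ∀ n : ℕ, f (n * τ) ≤ q ^ n * f 0 := by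
    intro n
    induction n with
    | zero => simp
    | succ n ih =>
      push_cast
      rw [add_mul, one_mul]
      calc f (n * τ + τ) ≤ q * f (n * τ) := hstep _ (by positivity)
        _ ≤ q * (q ^ n * f 0) := by gcongr
        _ = q ^ (n + 1) * f 0 := by ring
  have hfloor : ⌊t / τ⌋₊ * τ ≤ t := (le_div_iff₀ hτ).1 (Nat.floor_le (by positivity))
  have hrate : q⁻¹ * Real.exp (-(-Real.log q / τ) * t) = q ^ (t / τ - 1) := by
    rw [Real.rpow_sub_one hq.ne', Real.rpow_def_of_pos hq, div_eq_inv_mul _ q]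
    congr 2
    field_simp
  calc f t ≤ f (⌊t / τ⌋₊ * τ) := hanti (mem_Ici.2 (by positivity)) ht hfloor
    _ ≤ q ^ ⌊t / τ⌋₊ * f 0 := hpow _
    _ = q ^ (⌊t / τ⌋₊ : ℝ) * f 0 := by rw [Real.rpow_natCast]
    _ ≤ q ^ (t / τ - 1) * f 0 := by
        refine mul_le_mul_of_nonneg_right ?_ hf0
        exact Real.rpow_le_rpow_of_exponent_ge hq hq1.le
          (sub_le_iff_le_add.2 (Nat.lt_floor_add_one _).le)
    _ = _ := by rw [hrate]

variable {H : Type*} [NormedAddCommGroup H] [InnerProductSpace ℝ H] {D : Submodule ℝ H}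
  {F F' : D → H} {z w : ℝ → H}

theorem IsRightSolution.antitoneOn_norm (hF : ∀ x : D, ⟪(x : H), F x⟫_ℝ ≤ 0)
    (hz : IsRightSolution F z) : AntitoneOn (fun t => ‖z t‖) (Ici 0) := by
  intro s hs t _ hst
  refine (sq_le_sq₀ (norm_nonneg _) (norm_nonneg _)).1 ?_
  refine le_of_hasDerivWithinAt_Ici_nonpos (f := fun t => ‖z t‖ ^ 2) hst
    ((hz.continuousOn.mono fun r hr => le_trans hs hr.1).norm.pow 2) fun r hr => ?_
  have hr0 : 0 ≤ r := le_trans hs hr.1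
  exact ⟨_, mul_nonpos_of_nonneg_of_nonpos zero_le_two (hF ⟨z r, hz.mem hr0⟩),
    (hz.hasDerivWithinAt hr0).norm_sq⟩

theorem IsRightSolution.norm_sub_sq_add_le (hz : IsRightSolution F z) (hw : IsRightSolution F' w)
    {c τ : ℝ} (hτ : 0 ≤ τ)
    (hle : ∀ t (ht : 0 ≤ t), 2 * ⟪z t - w t, F ⟨z t, hz.mem ht⟩ - F' ⟨w t, hw.mem ht⟩⟫_ℝ +
      c * (2 * ⟪z t, F ⟨z t, hz.mem ht⟩⟫_ℝ) ≤ 0) :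
    ‖z τ - w τ‖ ^ 2 + c * ‖z τ‖ ^ 2 ≤ ‖z 0 - w 0‖ ^ 2 + c * ‖z 0‖ ^ 2 := by
  have hzc := hz.continuousOn.mono (Icc_subset_Ici_self (a := τ) (b := 0))
  have hwc := hw.continuousOn.mono (Icc_subset_Ici_self (a := τ) (b := 0))
  refine le_of_hasDerivWithinAt_Ici_nonpos (f := fun t => ‖z t - w t‖ ^ 2 + c * ‖z t‖ ^ 2) hτ
    (((hzc.sub hwc).norm.pow 2).add ((hzc.norm.pow 2).const_smul c)) fun t ht => ?_
  have hz' := hz.hasDerivWithinAt ht.1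
  exact ⟨_, hle t ht.1, (hz'.sub (hw.hasDerivWithinAt ht.1)).norm_sq.add
    (hz'.norm_sq.const_mul c)⟩

/-- If the reference point `b` has halved, so has, up to the dissipated energy, the point `a`. -/
theorem norm_sq_le_of_norm_sub_sq_add_le {E : Type*} [SeminormedAddCommGroup E] {a b : E}
    {c N : ℝ} (hc : 0 ≤ c) (hb : ‖b‖ ≤ 1 / 2 * N)
    (hab : ‖a - b‖ ^ 2 + c * ‖a‖ ^ 2 ≤ c * N ^ 2) :
    ‖a‖ ^ 2 ≤ (2 * c + 1 / 2) / (1 + 2 * c) * N ^ 2 := by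
  rw [div_mul_eq_mul_div, le_div_iff₀ (by positivity)]
  have htri : ‖a‖ ^ 2 ≤ (‖a - b‖ + 1 / 2 * N) ^ 2 := by
    gcongr
    linarith [norm_le_norm_sub_add a b]
  nlinarith [sq_nonneg (‖a - b‖ - 1 / 2 * N)]

end Comparison

section LinearDecay

variable {H : Type*} [NormedAddCommGroup H] [NormedSpace ℝ H] {L : H →ₗ.[ℝ] H}

theorem GloballyExpStable.exists_halving_time (hL : GloballyExpStable L) :
    ∃ T : ℝ → H →L[ℝ] H, IsC0Semigroup T ∧ IsGenerator T L ∧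
      (∃ C, 0 ≤ C ∧ ∀ t, 0 ≤ t → ∀ z, ‖T t z‖ ≤ C * ‖z‖) ∧
      ∃ τ > 0, ∀ z, ‖T τ z‖ ≤ 1 / 2 * ‖z‖ := by
  obtain ⟨T, hT, hgen, C, hC, α, hα, hdecay⟩ := hL
  refine ⟨T, hT, hgen, ⟨C, hC.le, fun t ht z => (hdecay z t ht).trans ?_⟩, 2 * C / α,
    by positivity, fun z => (hdecay z _ (by positivity)).trans ?_⟩
  · gcongr
    refine mul_le_of_le_one_right hC.le (Real.exp_le_one_iff.2 ?_)
    rw [neg_mul]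
    exact neg_nonpos.2 (by positivity)
  · gcongr
    rw [show -α * (2 * C / α) = -(2 * C) by field_simp, Real.exp_neg, ← div_eq_mul_inv,
      div_le_iff₀ (Real.exp_pos _)]
    linarith [Real.add_one_le_exp (2 * C)]

variable {T : ℝ → H →L[ℝ] H} {A : H →ₗ.[ℝ] H}

theorem IsGenerator.exists_apply_orbit_eq (hA : IsGenerator T A) (hT : IsC0Semigroup T) {t : ℝ}
    (ht : 0 ≤ t) (x : A.domain) : ∃ hx : T t x ∈ A.domain, A ⟨T t x, hx⟩ = T t (A x) := by
  have hmem := hA.map_mem_graph hT (A.mem_graph x) ht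
  exact ⟨A.mem_domain_of_mem_graph hmem, A.mem_graph_snd_inj (A.mem_graph _) hmem rfl⟩

theorem IsGenerator.exists_graphNorm_orbit_le (hA : IsGenerator T A) (hT : IsC0Semigroup T)
    {C t : ℝ} (ht : 0 ≤ t) (hC : ∀ z, ‖T t z‖ ≤ C * ‖z‖) (x : A.domain) :
    ∃ hx : T t x ∈ A.domain, graphNorm A ⟨T t x, hx⟩ ≤ C * graphNorm A x := by
  obtain ⟨hx, hAx⟩ := hA.exists_apply_orbit_eq hT ht x
  refine ⟨hx, ?_⟩
  rw [graphNorm, hAx, graphNorm, mul_add]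
  exact add_le_add (hC _) (hC _)

theorem IsGenerator.isRightSolution_orbit (hA : IsGenerator T A) (hT : IsC0Semigroup T)
    (x : A.domain) : IsRightSolution A fun t => T t x := by
  refine ⟨hT.continuousOn x, fun t ht => ?_⟩
  obtain ⟨hx, hAx⟩ := hA.exists_apply_orbit_eq hT ht x
  refine ⟨hx, ?_⟩
  rw [hAx]
  exact hA.hasDerivWithinAt_orbit hT (A.mem_graph x) ht

end LinearDecay

/-! ### Consequences of the damping inequality -/

section DampingInequality

variable {U : Type*} [NormedAddCommGroup U] [InnerProductSpace ℝ U]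
  {S : Type*} [NormedAddCommGroup S] [NormedSpace ℝ S]
  {ι : S →L[ℝ] U} {σ : U → S} {C₁ C₂ : ℝ} {h : ℝ → ℝ}

theorem abs_inner_le_dualNorm (ι : S →L[ℝ] U) (u : U) (s : S) :
    |⟪u, ι s⟫_ℝ| ≤ dualNorm ι u * ‖s‖ := by
  simpa [dualNorm] using ((innerSL ℝ u).comp ι).le_opNorm s

theorem IsGain.pos (hh : IsGain h) {x : ℝ} (hx : 0 ≤ x) : 0 < h x :=
  hh.pos_zero.trans_le (hh.mono hx)

theorem DampingInequality.inner_nonneg (hC₂ : 0 < C₂) (hh : IsGain h)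
    (hdamp : DampingInequality ι σ C₁ C₂ h) (s : S) : 0 ≤ ⟪ι (σ (ι s)), ι s⟫_ℝ :=
  nonneg_of_mul_nonneg_right ((norm_nonneg _).trans (hdamp s))
    (mul_pos hC₂ (hh.pos (norm_nonneg s)))

theorem DampingInequality.abs_inner_sub_le (hdamp : DampingInequality ι σ C₁ C₂ h) (s p : S) :
    |⟪ι (σ (ι s)) - C₁ • ι s, ι p⟫_ℝ| ≤ C₂ * h ‖s‖ * ⟪ι (σ (ι s)), ι s⟫_ℝ * ‖p‖ :=
  (abs_inner_le_dualNorm ι _ p).trans (mul_le_mul_of_nonneg_right (hdamp s) (norm_nonneg p))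

theorem DampingInequality.norm_sq_le (hdamp : DampingInequality ι σ C₁ C₂ h) (s : S) :
    C₁ * ‖ι s‖ ^ 2 ≤ (1 + C₂ * h ‖s‖ * ‖s‖) * ⟪ι (σ (ι s)), ι s⟫_ℝ := by
  have hdefect := neg_le_of_abs_le (hdamp.abs_inner_sub_le s s)
  rw [inner_sub_left, real_inner_smul_left, real_inner_self_eq_norm_sq] at hdefect
  linarith

theorem DampingInequality.exists_inner_sub_sub_le (hC₁ : 0 < C₁) (hC₂ : 0 < C₂) (hh : IsGain h)
    (hdamp : DampingInequality ι σ C₁ C₂ h) (R R' : ℝ) :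
    ∃ c, 0 ≤ c ∧ ∀ s p : S, ‖s‖ ≤ R → ‖p‖ ≤ R' →
      ⟪ι p, ι s - ι p - ι (σ (ι s))⟫_ℝ ≤ c * ⟪ι (σ (ι s)), ι s⟫_ℝ := by
  have hC₂h : 0 ≤ C₂ * h R := mul_nonneg hC₂.le (hh.nonneg R)
  refine ⟨C₂ * h R * |R'| + (C₁ - 1) ^ 2 / (4 * C₁) * (1 + C₂ * h R * |R|), by positivity,
    fun s p hs hp => ?_⟩
  set θ := ⟪ι (σ (ι s)), ι s⟫_ℝ
  have hθ : 0 ≤ θ := hdamp.inner_nonneg hC₂ hh s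
  have hhs : h ‖s‖ ≤ h R := hh.mono hs
  have hdefect : -⟪ι (σ (ι s)) - C₁ • ι s, ι p⟫_ℝ ≤ C₂ * h R * |R'| * θ :=
    calc -⟪ι (σ (ι s)) - C₁ • ι s, ι p⟫_ℝ ≤ C₂ * h ‖s‖ * θ * ‖p‖ :=
          neg_le.1 (neg_le_of_abs_le (hdamp.abs_inner_sub_le s p))
      _ ≤ C₂ * h R * θ * |R'| := by
          gcongr
          exact hp.trans (le_abs_self R')
      _ = C₂ * h R * |R'| * θ := by ring
  have hnormal : (C₁ - 1) ^ 2 / 4 * ‖ι s‖ ^ 2 ≤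
      (C₁ - 1) ^ 2 / (4 * C₁) * (1 + C₂ * h R * |R|) * θ :=
    calc (C₁ - 1) ^ 2 / 4 * ‖ι s‖ ^ 2 = (C₁ - 1) ^ 2 / (4 * C₁) * (C₁ * ‖ι s‖ ^ 2) := by
          field_simp
      _ ≤ (C₁ - 1) ^ 2 / (4 * C₁) * ((1 + C₂ * h R * |R|) * θ) := by
          refine mul_le_mul_of_nonneg_left ((hdamp.norm_sq_le s).trans ?_) (by positivity)
          gcongr
          exact hs.trans (le_abs_self R)
      _ = _ := by ring
  have hyoung : -((C₁ - 1) * ⟪ι p, ι s⟫_ℝ) ≤ ‖ι p‖ ^ 2 + (C₁ - 1) ^ 2 / 4 * ‖ι s‖ ^ 2 := by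
    have hsquare := norm_add_sq_real (ι p) (((C₁ - 1) / 2) • ι s)
    rw [real_inner_smul_right, norm_smul, Real.norm_eq_abs, mul_pow, sq_abs] at hsquare
    linarith [sq_nonneg ‖ι p + ((C₁ - 1) / 2) • ι s‖]
  have hsplit : ⟪ι p, ι s - ι p - ι (σ (ι s))⟫_ℝ =
      -⟪ι (σ (ι s)) - C₁ • ι s, ι p⟫_ℝ - (C₁ - 1) * ⟪ι p, ι s⟫_ℝ - ‖ι p‖ ^ 2 := by
    rw [inner_sub_left, inner_sub_right, inner_sub_right, real_inner_self_eq_norm_sq,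
      real_inner_smul_left, real_inner_comm (ι p) (ι s), real_inner_comm (ι p) (ι (σ _))]
    ring
  linarith

theorem norm_le_dualNorm (hiso : Isometry ι) (hsurj : Function.Surjective ι) (u : U) :
    ‖u‖ ≤ dualNorm ι u := by
  obtain ⟨s, rfl⟩ := hsurj u
  have hs : ‖ι s‖ = ‖s‖ := hiso.norm_map_of_map_zero (map_zero ι) s
  have hpair := abs_inner_le_dualNorm ι (ι s) s
  rw [real_inner_self_eq_norm_mul_norm, abs_mul_self, ← hs] at hpair
  rcases (norm_nonneg (ι s)).eq_or_lt with h0 | hpos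
  · exact h0.symm.trans_le (norm_nonneg _)
  · exact le_of_mul_le_mul_right hpair hpos

theorem DampingInequality.norm_sub_le (hiso : Isometry ι) (hsurj : Function.Surjective ι)
    (hdamp : DampingInequality ι σ C₁ C₂ h) (u : U) :
    ‖ι (σ u) - C₁ • u‖ ≤ C₂ * h ‖u‖ * ⟪ι (σ u), u⟫_ℝ := by
  obtain ⟨s, rfl⟩ := hsurj u
  rw [hiso.norm_map_of_map_zero (map_zero ι) s]
  exact (norm_le_dualNorm hiso hsurj _).trans (hdamp s)

end DampingInequality

/-! ### Closed loops -/

section ClosedLoop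

variable {H : Type*} [NormedAddCommGroup H] [InnerProductSpace ℝ H] [CompleteSpace H]
  {U : Type*} [NormedAddCommGroup U] [InnerProductSpace ℝ U] [CompleteSpace U]
  {A : H →ₗ.[ℝ] H} {B : U →L[ℝ] H} {φ : U → U}

/-- The term `-B φ(B* z)` by which the collocated feedback law `φ` perturbs `z' = A z`. The gain
`√k` of the closed loops is absorbed in `B`. -/
noncomputable def feedback (B : U →L[ℝ] H) (φ : U → U) (z : H) : H :=
  -B (φ (ContinuousLinearMap.adjoint B z))

theorem linearClosedLoop_apply (A : H →ₗ.[ℝ] H) (B : U →L[ℝ] H) (c : ℝ) (z : A.domain) :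
    linearClosedLoop A B c z = A z + feedback B (fun u => c • u) z := by
  rw [feedback, map_smul, ← sub_eq_add_neg]
  rfl

theorem linearClosedLoop_sqrt_smul_apply (A : H →ₗ.[ℝ] H) (B : U →L[ℝ] H) {k : ℝ} (hk : 0 ≤ k)
    (c : ℝ) (z : A.domain) :
    linearClosedLoop A (√k • B) c z = linearClosedLoop A B (k * c) z := by
  refine (linearClosedLoop_apply A _ c z).trans
    (Eq.trans ?_ (linearClosedLoop_apply A B (k * c) z).symm)
  have hgain : √k * c * √k = k * c := by rw [mul_right_comm, Real.mul_self_sqrt hk]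
  simp [feedback, smul_smul, ← hgain, mul_comm, mul_left_comm]

theorem linearClosedLoop_sqrt_smul (A : H →ₗ.[ℝ] H) (B : U →L[ℝ] H) {k : ℝ} (hk : 0 ≤ k) (c : ℝ) :
    linearClosedLoop A (√k • B) c = linearClosedLoop A B (k * c) :=
  LinearPMap.ext rfl fun x hx _ => linearClosedLoop_sqrt_smul_apply A B hk c ⟨x, hx⟩

theorem nonlinearClosedLoop_eq (A : H →ₗ.[ℝ] H) (B : U →L[ℝ] H) (k : ℝ)
    {S : Type*} [NormedAddCommGroup S] [NormedSpace ℝ S] (ι : S →L[ℝ] U) (σ : U → S) :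
    nonlinearClosedLoop A B k ι σ =
      fun z : A.domain => A z + feedback (√k • B) (fun u => ι (σ u)) z := by
  funext z
  simp [nonlinearClosedLoop, feedback, sub_eq_add_neg]

theorem inner_feedback (x y : H) : ⟪x, feedback B φ y⟫_ℝ =
    -⟪ContinuousLinearMap.adjoint B x, φ (ContinuousLinearMap.adjoint B y)⟫_ℝ := by
  rw [feedback, inner_neg_right, ContinuousLinearMap.adjoint_inner_left]

theorem locallyLipschitz_feedback (hφ : LocallyLipschitz φ) : LocallyLipschitz (feedback B φ) :=
  ((-B).lipschitz.locallyLipschitz.comp hφ).comp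
    (ContinuousLinearMap.adjoint B).lipschitz.locallyLipschitz

theorem isDissipative_feedback (hφ : ∀ u v, 0 ≤ ⟪φ u - φ v, u - v⟫_ℝ) :
    IsDissipative (feedback B φ) := fun x y => by
  have hmono := hφ (ContinuousLinearMap.adjoint B x) (ContinuousLinearMap.adjoint B y)
  rw [← map_sub, ContinuousLinearMap.adjoint_inner_right, map_sub] at hmono
  rw [feedback, feedback, ← neg_sub_neg, neg_neg, neg_neg, ← neg_sub, inner_neg_left]
  exact neg_nonpos.2 hmono

theorem norm_adjoint_apply_le (B : U →L[ℝ] H) (x : H) :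
    ‖ContinuousLinearMap.adjoint B x‖ ≤ ‖B‖ * ‖x‖ := by
  simpa only [LinearIsometryEquiv.norm_map] using (ContinuousLinearMap.adjoint B).le_opNorm x

theorem exists_norm_feedback_le (B : U →L[ℝ] H)
    (hφ : ∀ R : ℝ, ∃ L : ℝ, ∀ u : U, ‖u‖ ≤ R → ‖φ u‖ ≤ L) (r : ℝ) :
    ∃ Γ, ∀ x : H, ‖x‖ ≤ r → ‖feedback B φ x‖ ≤ Γ := by
  obtain ⟨L, hL⟩ := hφ (‖B‖ * r)
  refine ⟨‖B‖ * L, fun x hx => ?_⟩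
  rw [feedback, norm_neg]
  refine B.le_opNorm_of_le (hL _ ((norm_adjoint_apply_le B x).trans ?_))
  gcongr

end ClosedLoop

/-! ### Semi-global exponential stability -/

section GraphNorm

variable {H : Type*} [NormedAddCommGroup H] [NormedSpace ℝ H] {A : H →ₗ.[ℝ] H}

theorem graphNorm_nonneg (x : A.domain) : 0 ≤ graphNorm A x :=
  add_nonneg (norm_nonneg _) (norm_nonneg _)

theorem norm_le_graphNorm (x : A.domain) : ‖(x : H)‖ ≤ graphNorm A x :=
  le_add_of_nonneg_right (norm_nonneg _)

theorem graphNorm_sub_le (x y : A.domain) :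
    graphNorm A (x - y) ≤ graphNorm A x + graphNorm A y := by
  simp only [graphNorm, A.map_sub, AddSubgroupClass.coe_sub]
  linarith [norm_sub_le (x : H) y, norm_sub_le (A x) (A y)]

theorem graphNorm_le_add_of_norm_le {G : H → H} {x y : A.domain} {Γ : ℝ}
    (hxy : ‖(y : H)‖ ≤ ‖(x : H)‖) (hspeed : ‖A y + G y‖ ≤ ‖A x + G x‖)
    (hx : ‖G x‖ ≤ Γ) (hy : ‖G y‖ ≤ Γ) : graphNorm A y ≤ graphNorm A x + 2 * Γ := by
  have hAy := norm_le_norm_add_norm_sub' (A y) (A y + G y)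
  rw [sub_add_cancel_left, norm_neg] at hAy
  simp only [graphNorm]
  linarith [norm_add_le (A x) (G x)]

end GraphNorm

section SemiGlobal

variable {H : Type*} [NormedAddCommGroup H] [InnerProductSpace ℝ H] [CompleteSpace H]
  {U : Type*} [NormedAddCommGroup U] [InnerProductSpace ℝ U] [CompleteSpace U]
  {A : H →ₗ.[ℝ] H} {B : U →L[ℝ] H}

theorem norm_feedback_smul_le (B : U →L[ℝ] H) (c : ℝ) (z : H) :
    ‖feedback B (fun u => c • u) z‖ ≤ |c| * ‖B‖ ^ 2 * ‖z‖ := by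
  rw [feedback, norm_neg]
  calc ‖B (c • ContinuousLinearMap.adjoint B z)‖
      ≤ ‖B‖ * (|c| * (‖B‖ * ‖z‖)) := by
        refine B.le_opNorm_of_le ?_
        rw [norm_smul, Real.norm_eq_abs]
        gcongr
        exact norm_adjoint_apply_le B z
    _ = |c| * ‖B‖ ^ 2 * ‖z‖ := by ring

theorem graphNorm_linearClosedLoop_le (A : H →ₗ.[ℝ] H) (B : U →L[ℝ] H) (c : ℝ) (x : A.domain) :
    graphNorm (linearClosedLoop A B c) x ≤ (1 + |c| * ‖B‖ ^ 2) * graphNorm A x := by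
  have hfeedback := norm_feedback_smul_le B c (x : H)
  have hx : 0 ≤ |c| * ‖B‖ ^ 2 * ‖A x‖ := by positivity
  simp only [graphNorm, linearClosedLoop_apply]
  linarith [norm_add_le (A x) (feedback B (fun u => c • u) x)]

theorem graphNorm_le_graphNorm_linearClosedLoop (A : H →ₗ.[ℝ] H) (B : U →L[ℝ] H) (c : ℝ)
    (x : A.domain) :
    graphNorm A x ≤ (1 + |c| * ‖B‖ ^ 2) * graphNorm (linearClosedLoop A B c) x := by
  have hfeedback := norm_feedback_smul_le B c (x : H)
  have hx : 0 ≤ |c| * ‖B‖ ^ 2 * ‖A x + feedback B (fun u => c • u) x‖ := by positivity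
  have hAx := norm_le_norm_add_norm_sub' (A x) (A x + feedback B (fun u => c • u) x)
  rw [sub_add_cancel_left, norm_neg] at hAx
  simp only [graphNorm, linearClosedLoop_apply]
  linarith

theorem exists_graphNorm_linearClosedLoop_orbit_le {T : ℝ → H →L[ℝ] H} {c C t : ℝ}
    (hgen : IsGenerator T (linearClosedLoop A B c)) (hT : IsC0Semigroup T) (hC : 0 ≤ C)
    (ht : 0 ≤ t) (hTt : ∀ z, ‖T t z‖ ≤ C * ‖z‖) (x : A.domain) :
    ∃ hx : T t x ∈ A.domain,
      graphNorm A ⟨T t x, hx⟩ ≤ (1 + |c| * ‖B‖ ^ 2) ^ 2 * C * graphNorm A x := by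
  obtain ⟨hx, horbit⟩ := hgen.exists_graphNorm_orbit_le hT ht hTt x
  refine ⟨hx, ?_⟩
  calc graphNorm A ⟨T t x, hx⟩
      ≤ (1 + |c| * ‖B‖ ^ 2) * graphNorm (linearClosedLoop A B c) ⟨T t x, hx⟩ :=
        graphNorm_le_graphNorm_linearClosedLoop A B c ⟨T t x, hx⟩
    _ ≤ (1 + |c| * ‖B‖ ^ 2) * (C * ((1 + |c| * ‖B‖ ^ 2) * graphNorm A x)) := by
        gcongr
        refine horbit.trans ?_
        gcongr
        exact graphNorm_linearClosedLoop_le A B c x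
    _ = (1 + |c| * ‖B‖ ^ 2) ^ 2 * C * graphNorm A x := by ring

variable {S : Type*} [NormedAddCommGroup S] [NormedSpace ℝ S]
  {ι : S →L[ℝ] U} {σ : U → S} {C₁ C₂ : ℝ} {h : ℝ → ℝ} {cS : ℝ}

theorem exists_lift_norm_le (hS : ∀ z : A.domain, ∃ s : S,
      ι s = ContinuousLinearMap.adjoint B (z : H) ∧ ‖s‖ ≤ cS * graphNorm A z)
    {r : ℝ} {z : A.domain} (hz : graphNorm A z ≤ r) :
    ∃ s : S, ι s = ContinuousLinearMap.adjoint B (z : H) ∧ ‖s‖ ≤ |cS| * r := by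
  obtain ⟨s, hs, hsz⟩ := hS z
  refine ⟨s, hs, hsz.trans ?_⟩
  calc cS * graphNorm A z ≤ |cS| * graphNorm A z :=
        mul_le_mul_of_nonneg_right (le_abs_self cS) (graphNorm_nonneg z)
    _ ≤ |cS| * r := by gcongr

theorem inner_add_feedback {x : A.domain} {s : S}
    (hs : ι s = ContinuousLinearMap.adjoint B (x : H)) :
    ⟪(x : H), A x + feedback B (fun u => ι (σ u)) x⟫_ℝ =
      ⟪A x, (x : H)⟫_ℝ - ⟪ι (σ (ι s)), ι s⟫_ℝ := by
  rw [inner_add_right, inner_feedback, ← hs, real_inner_comm, real_inner_comm (ι (σ (ι s))),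
    sub_eq_add_neg]

theorem inner_add_feedback_nonpos (hA : ∀ x : A.domain, ⟪A x, (x : H)⟫_ℝ ≤ 0) (hC₂ : 0 < C₂)
    (hh : IsGain h) (hdamp : DampingInequality ι σ C₁ C₂ h) {x : A.domain} {s : S}
    (hs : ι s = ContinuousLinearMap.adjoint B (x : H)) :
    ⟪(x : H), A x + feedback B (fun u => ι (σ u)) x⟫_ℝ ≤ 0 := by
  rw [inner_add_feedback hs]
  exact sub_nonpos.2 ((hA x).trans (hdamp.inner_nonneg hC₂ hh s))

/-- The dissipated energy `-⟪a, A_σ a⟫` pays for the difference between the nonlinear field at `a`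
and the linear one at `b`, on balls of `D(A)`. -/
theorem DampingInequality.exists_inner_sub_linearClosedLoop_le
    (hA : ∀ x : A.domain, ⟪A x, (x : H)⟫_ℝ ≤ 0) (hC₁ : 0 < C₁) (hC₂ : 0 < C₂) (hh : IsGain h)
    (hdamp : DampingInequality ι σ C₁ C₂ h)
    (hS : ∀ z : A.domain, ∃ s : S,
      ι s = ContinuousLinearMap.adjoint B (z : H) ∧ ‖s‖ ≤ cS * graphNorm A z) (r₁ r₂ : ℝ) :
    ∃ c, 0 ≤ c ∧ ∀ a b : A.domain, graphNorm A a ≤ r₁ → graphNorm A b ≤ r₂ →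
      2 * ⟪(a : H) - b,
          A a + feedback B (fun u => ι (σ u)) a - linearClosedLoop A B 1 b⟫_ℝ +
        c * (2 * ⟪(a : H), A a + feedback B (fun u => ι (σ u)) a⟫_ℝ) ≤ 0 := by
  obtain ⟨c, hc, hbound⟩ := hdamp.exists_inner_sub_sub_le hC₁ hC₂ hh (|cS| * r₁)
    (|cS| * (r₁ + r₂))
  refine ⟨c, hc, fun a b ha hb => ?_⟩
  obtain ⟨s, hs, hsr⟩ := exists_lift_norm_le hS ha
  obtain ⟨p, hp, hpr⟩ := exists_lift_norm_le hS ((graphNorm_sub_le a b).trans (add_le_add ha hb))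
  have hdefect := hbound s p hsr hpr
  have hb' : ContinuousLinearMap.adjoint B (b : H) = ι s - ι p := by
    rw [hs, hp, ← map_sub, AddSubgroupClass.coe_sub, sub_sub_cancel]
  have hdiff : ⟪(a : H) - b, A a + feedback B (fun u => ι (σ u)) a - linearClosedLoop A B 1 b⟫_ℝ =
      ⟪A (a - b), ((a - b : A.domain) : H)⟫_ℝ + ⟪ι p, ι s - ι p - ι (σ (ι s))⟫_ℝ := by
    rw [linearClosedLoop_apply, add_sub_add_comm, ← A.map_sub, inner_add_right, inner_sub_right,
      inner_feedback, inner_feedback, ← AddSubgroupClass.coe_sub, ← hp, hb', ← hs, real_inner_comm,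
      inner_sub_right (ι p) (ι s - ι p), one_smul]
    ring
  rw [hdiff, inner_add_feedback hs]
  nlinarith [hA (a - b), mul_nonpos_of_nonneg_of_nonpos hc (hA a)]

theorem exists_norm_le_mul_of_graphNorm_le (hA : ∀ x : A.domain, ⟪A x, (x : H)⟫_ℝ ≤ 0)
    (hexp : GloballyExpStable (linearClosedLoop A B 1)) (hC₁ : 0 < C₁) (hC₂ : 0 < C₂)
    (hh : IsGain h) (hdamp : DampingInequality ι σ C₁ C₂ h)
    (hS : ∀ z : A.domain, ∃ s : S,
      ι s = ContinuousLinearMap.adjoint B (z : H) ∧ ‖s‖ ≤ cS * graphNorm A z) (R : ℝ) :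
    ∃ τ > 0, ∃ q, 0 < q ∧ q < 1 ∧ ∀ (z : ℝ → H)
      (hz : IsRightSolution (fun x : A.domain => A x + feedback B (fun u => ι (σ u)) x) z),
      (∀ t (ht : 0 ≤ t), graphNorm A ⟨z t, hz.mem ht⟩ ≤ R) → ‖z τ‖ ≤ q * ‖z 0‖ := by
  obtain ⟨T, hT, hgen, ⟨C, hC, hTC⟩, τ, hτ, hhalf⟩ := hexp.exists_halving_time
  obtain ⟨c, hc, hdiss⟩ := hdamp.exists_inner_sub_linearClosedLoop_le hA hC₁ hC₂ hh hS R
    ((1 + |1| * ‖B‖ ^ 2) ^ 2 * C * R)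
  have hq : (2 * c + 1 / 2) / (1 + 2 * c) < 1 := by
    rw [div_lt_one (by positivity)]
    linarith
  refine ⟨τ, hτ, √((2 * c + 1 / 2) / (1 + 2 * c)), by positivity,
    (Real.sqrt_lt' one_pos).2 (by rwa [one_pow]), fun z hz hR => ?_⟩
  set x : A.domain := ⟨z 0, hz.mem le_rfl⟩
  have hw := hgen.isRightSolution_orbit hT x
  have hcompare := hz.norm_sub_sq_add_le hw hτ.le fun t ht => by
    obtain ⟨hwt, hgraph⟩ := exists_graphNorm_linearClosedLoop_orbit_le hgen hT hC ht (hTC t ht) x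
    exact hdiss ⟨z t, hz.mem ht⟩ ⟨T t x, hwt⟩ (hR t ht)
      (hgraph.trans (mul_le_mul_of_nonneg_left (hR 0 le_rfl) (by positivity)))
  have hcontract := norm_sq_le_of_norm_sub_sq_add_le hc (hhalf (z 0))
    (by simpa [x, hT.map_zero] using hcompare)
  calc ‖z τ‖ = √(‖z τ‖ ^ 2) := (Real.sqrt_sq (norm_nonneg _)).symm
    _ ≤ √((2 * c + 1 / 2) / (1 + 2 * c) * ‖z 0‖ ^ 2) := Real.sqrt_le_sqrt hcontract
    _ = √((2 * c + 1 / 2) / (1 + 2 * c)) * ‖z 0‖ := by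
        rw [Real.sqrt_mul (by positivity), Real.sqrt_sq (norm_nonneg _)]

theorem exists_norm_le_exp_of_graphNorm_le (hA : ∀ x : A.domain, ⟪A x, (x : H)⟫_ℝ ≤ 0)
    (hexp : GloballyExpStable (linearClosedLoop A B 1)) (hC₁ : 0 < C₁) (hC₂ : 0 < C₂)
    (hh : IsGain h) (hdamp : DampingInequality ι σ C₁ C₂ h)
    (hS : ∀ z : A.domain, ∃ s : S,
      ι s = ContinuousLinearMap.adjoint B (z : H) ∧ ‖s‖ ≤ cS * graphNorm A z) (R : ℝ) :
    ∃ K > 0, ∃ μ > 0, ∀ (z : ℝ → H)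
      (hz : IsRightSolution (fun x : A.domain => A x + feedback B (fun u => ι (σ u)) x) z),
      (∀ t (ht : 0 ≤ t), graphNorm A ⟨z t, hz.mem ht⟩ ≤ R) →
      ∀ t, 0 ≤ t → ‖z t‖ ≤ K * Real.exp (-μ * t) * ‖z 0‖ := by
  obtain ⟨τ, hτ, q, hq, hq1, hstep⟩ :=
    exists_norm_le_mul_of_graphNorm_le hA hexp hC₁ hC₂ hh hdamp hS R
  refine ⟨q⁻¹, inv_pos.2 hq, -Real.log q / τ,
    div_pos (neg_pos.2 (Real.log_neg hq hq1)) hτ, fun z hz hR t ht => ?_⟩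
  refine le_exp_of_contraction (f := fun t => ‖z t‖) hq hq1 hτ (norm_nonneg _)
    (hz.antitoneOn_norm fun x => ?_) (fun s hs => ?_) ht
  · obtain ⟨s, hs, -⟩ := hS x
    exact inner_add_feedback_nonpos hA hC₂ hh hdamp hs
  · simpa using hstep _ (hz.shift hs) fun t ht => hR (s + t) (add_nonneg hs ht)

theorem semiGloballyExpStable_of_monotone (hA : GeneratesContractionSemigroup A)
    (hexp : GloballyExpStable (linearClosedLoop A B 1))
    (hσ : LocallyLipschitz fun u => ι (σ u)) (hC₁ : 0 < C₁) (hC₂ : 0 < C₂) (hh : IsGain h)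
    (hdamp : DampingInequality ι σ C₁ C₂ h) (hmono : MonotoneDamping ι σ)
    (hbdd : ∀ R : ℝ, ∃ L : ℝ, ∀ u : U, ‖u‖ ≤ R → ‖ι (σ u)‖ ≤ L)
    (hS : ∀ z : A.domain, ∃ s : S,
      ι s = ContinuousLinearMap.adjoint B (z : H) ∧ ‖s‖ ≤ cS * graphNorm A z) :
    SemiGloballyExpStable A fun x => A x + feedback B (fun u => ι (σ u)) x := by
  classical
  obtain ⟨T, hT, hgen⟩ := hA.exists_isContractionSemigroup
  have hAdiss := hgen.inner_nonpos hT
  have hdiss : IsDissipative (feedback B fun u => ι (σ u)) := isDissipative_feedback hmono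
  choose Z hZ hZ0 hspeed using
    exists_isRightSolution hT hgen (locallyLipschitz_feedback (B := B) hσ) hdiss
  have hnorm : ∀ (x : A.domain) t, 0 ≤ t → ‖Z x t‖ ≤ ‖(x : H)‖ := fun x t ht => by
    refine (((hZ x).antitoneOn_norm fun y => ?_) self_mem_Ici ht ht).trans_eq (by simp only [hZ0])
    obtain ⟨s, hs, -⟩ := hS y
    exact inner_add_feedback_nonpos hAdiss hC₂ hh hdamp hs
  have hfield : ∀ x y : A.domain, ⟪A x + feedback B (fun u => ι (σ u)) x -
      (A y + feedback B (fun u => ι (σ u)) y), (x : H) - y⟫_ℝ ≤ 0 := fun x y => by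
    rw [add_sub_add_comm, ← A.map_sub, inner_add_left]
    exact add_nonpos (hAdiss (x - y)) (hdiss x y)
  refine ⟨fun t x => if hx : x ∈ A.domain then Z ⟨x, hx⟩ t else 0, fun x => ?_, fun r _ => ?_⟩
  · have hsol := (hZ x).isStrongSolution (hspeed x)
    rw [hZ0] at hsol
    simp only [x.2, dite_true]
    exact ⟨hsol, fun z hz t ht => hz.eqOn hfield hsol ht⟩
  · obtain ⟨Γ, hΓ⟩ := exists_norm_feedback_le B hbdd r
    obtain ⟨K, hK, μ, hμ, hdecay⟩ :=
      exists_norm_le_exp_of_graphNorm_le hAdiss hexp hC₁ hC₂ hh hdamp hS (r + 2 * Γ)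
    refine ⟨K, hK, μ, hμ, fun x hx t ht => ?_⟩
    have hxr := (norm_le_graphNorm x).trans hx
    simp only [x.2, dite_true]
    refine (hdecay (Z x) (hZ x) (fun t ht => ?_) t ht).trans_eq (by rw [hZ0])
    refine (graphNorm_le_add_of_norm_le (hnorm x t ht) (hspeed x t ht) (hΓ x hxr)
      (hΓ _ ((hnorm x t ht).trans hxr))).trans ?_
    gcongr

end SemiGlobal

/-! ### Quadratic Lyapunov functions -/

section LyapunovOperator

variable {H : Type*} [NormedAddCommGroup H] [InnerProductSpace ℝ H]

theorem exists_gramian [CompleteSpace H] {T : ℝ → H →L[ℝ] H} {a b : ℝ}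
    (hT : ∀ z, ContinuousOn (fun t => T t z) (uIcc a b)) :
    ∃ P : H →L[ℝ] H, IsSelfAdjoint P ∧ ∀ z w : H, ⟪P z, w⟫_ℝ = ∫ t in a..b, ⟪T t z, T t w⟫_ℝ := by
  have hint : ∀ z w : H, IntervalIntegrable (fun t => ⟪T t z, T t w⟫_ℝ) volume a b := fun z w =>
    ((hT z).inner (hT w)).intervalIntegrable
  obtain ⟨C, hC⟩ : ∃ C, ∀ t : uIcc a b, ‖T t‖ ≤ C := banach_steinhaus fun z => by
    obtain ⟨C, hC⟩ := isCompact_uIcc.exists_bound_of_continuousOn (hT z)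
    exact ⟨C, fun t => hC t t.2⟩
  let form : H →ₗ[ℝ] H →ₗ[ℝ] ℝ := LinearMap.mk₂ ℝ
    (fun z w => ∫ t in a..b, ⟪T t z, T t w⟫_ℝ)
    (fun z₁ z₂ w => by
      simp only [map_add, inner_add_left]
      exact intervalIntegral.integral_add (hint _ _) (hint _ _))
    (fun c z w => by
      simp only [map_smul, real_inner_smul_left]
      exact intervalIntegral.integral_const_mul _ _)
    (fun z w₁ w₂ => by
      simp only [map_add, inner_add_right]
      exact intervalIntegral.integral_add (hint _ _) (hint _ _))
    (fun c z w => by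
      simp only [map_smul, real_inner_smul_right]
      exact intervalIntegral.integral_const_mul _ _)
  have hform : ∀ z w, ‖form z w‖ ≤ C * C * |b - a| * ‖z‖ * ‖w‖ := fun z w => by
    have hbound : ‖form z w‖ ≤ C * ‖z‖ * (C * ‖w‖) * |b - a| := by
      refine intervalIntegral.norm_integral_le_of_norm_le_const fun t ht => ?_
      have hTC := hC ⟨t, uIoc_subset_uIcc ht⟩
      exact (norm_inner_le_norm _ _).trans (mul_le_mul ((T t).le_of_opNorm_le hTC z)
        ((T t).le_of_opNorm_le hTC w) (norm_nonneg _)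
        ((norm_nonneg _).trans ((T t).le_of_opNorm_le hTC z)))
    linarith
  let P : H →L[ℝ] H := InnerProductSpace.continuousLinearMapOfBilin (form.mkContinuous₂ _ hform)
  have hP : ∀ z w : H, ⟪P z, w⟫_ℝ = ∫ t in a..b, ⟪T t z, T t w⟫_ℝ :=
    InnerProductSpace.continuousLinearMapOfBilin_apply _
  refine ⟨P, ContinuousLinearMap.isSelfAdjoint_iff_isSymmetric.2 fun z w => ?_, hP⟩
  change ⟪P z, w⟫_ℝ = ⟪z, P w⟫_ℝ
  rw [real_inner_comm (P w) z, hP, hP]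
  simp only [real_inner_comm]

theorem IsGenerator.integral_inner_orbit {T : ℝ → H →L[ℝ] H} {A : H →ₗ.[ℝ] H}
    (hA : IsGenerator T A) (hT : IsC0Semigroup T) {τ : ℝ} (hτ : 0 ≤ τ) (x : A.domain) :
    ∫ t in (0 : ℝ)..τ, 2 * ⟪T t x, T t (A x)⟫_ℝ = ‖T τ x‖ ^ 2 - ‖(x : H)‖ ^ 2 := by
  have hcont : ∀ z, ContinuousOn (fun t => T t z) (Icc 0 τ) := fun z =>
    (hT.continuousOn z).mono Icc_subset_Ici_self
  rw [intervalIntegral.integral_eq_sub_of_hasDeriv_right_of_le hτ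
    (f := fun t => ‖T t x‖ ^ 2) ((hcont x).norm.pow 2)
    (fun t ht => ((hA.hasDerivWithinAt_orbit hT (A.mem_graph x) ht.1.le).mono
      Ioi_subset_Ici_self).norm_sq)
    ((((hcont x).inner (hcont (A x))).const_smul (2 : ℝ)).intervalIntegrable_of_Icc hτ)]
  rw [hT.map_zero, ContinuousLinearMap.id_apply]

variable [CompleteSpace H]

theorem GloballyExpStable.exists_lyapunov_operator {L : H →ₗ.[ℝ] H} (hL : GloballyExpStable L) :
    ∃ P : H →L[ℝ] H, IsSelfAdjoint P ∧ (∀ z, 0 ≤ ⟪P z, z⟫_ℝ) ∧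
      ∀ z : L.domain, 2 * ⟪P z, L z⟫_ℝ ≤ -(1 / 2) * ‖(z : H)‖ ^ 2 := by
  obtain ⟨T, hT, hgen, -, τ, hτ, hhalf⟩ := hL.exists_halving_time
  obtain ⟨P, hsa, hP⟩ := exists_gramian (T := T) (a := 0) (b := τ) fun z => by
    rw [uIcc_of_le hτ.le]
    exact (hT.continuousOn z).mono Icc_subset_Ici_self
  refine ⟨P, hsa, fun z => ?_, fun z => ?_⟩
  · rw [hP]
    exact intervalIntegral.integral_nonneg hτ.le fun t _ => real_inner_self_nonneg
  · have hτz : ‖T τ z‖ ^ 2 ≤ (1 / 2 * ‖(z : H)‖) ^ 2 := by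
      gcongr
      exact hhalf z
    rw [hP, ← intervalIntegral.integral_const_mul, hgen.integral_inner_orbit hT hτ.le]
    linarith [sq_nonneg ‖(z : H)‖]

variable {U : Type*} [NormedAddCommGroup U] [InnerProductSpace ℝ U] [CompleteSpace U]
  {A : H →ₗ.[ℝ] H} {B : U →L[ℝ] H}

theorem inner_linearClosedLoop (A : H →ₗ.[ℝ] H) (B : U →L[ℝ] H) (c : ℝ) (x : H) (z : A.domain) :
    ⟪x, linearClosedLoop A B c z⟫_ℝ = ⟪x, A z⟫_ℝ -
      c * ⟪ContinuousLinearMap.adjoint B x, ContinuousLinearMap.adjoint B (z : H)⟫_ℝ := by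
  rw [linearClosedLoop_apply, inner_add_right, inner_feedback, real_inner_smul_right,
    sub_eq_add_neg]

theorem norm_adjoint_apply_apply_le (B : U →L[ℝ] H) (P : H →L[ℝ] H) (z : H) :
    ‖ContinuousLinearMap.adjoint B (P z)‖ ≤ ‖B‖ * ‖P‖ * ‖z‖ := by
  rw [mul_assoc]
  exact (norm_adjoint_apply_le B _).trans
    (mul_le_mul_of_nonneg_left (P.le_opNorm z) (norm_nonneg B))

theorem two_mul_inner_linearClosedLoop_le (A : H →ₗ.[ℝ] H) (B : U →L[ℝ] H) (P : H →L[ℝ] H)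
    (c c' : ℝ) (z : A.domain) :
    2 * ⟪P z, linearClosedLoop A B c' z⟫_ℝ ≤ 2 * ⟪P z, linearClosedLoop A B c z⟫_ℝ +
      1 / 4 * ‖(z : H)‖ ^ 2 +
      4 * (|c - c'| * (‖B‖ * ‖P‖)) ^ 2 * ‖ContinuousLinearMap.adjoint B (z : H)‖ ^ 2 := by
  rw [inner_linearClosedLoop, inner_linearClosedLoop]
  set β := ContinuousLinearMap.adjoint B (z : H)
  set p := ContinuousLinearMap.adjoint B (P z)
  have hchange : (c - c') * ⟪p, β⟫_ℝ ≤ |c - c'| * (‖B‖ * ‖P‖) * ‖(z : H)‖ * ‖β‖ :=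
    calc (c - c') * ⟪p, β⟫_ℝ ≤ |c - c'| * |⟪p, β⟫_ℝ| := (le_abs_self _).trans_eq (abs_mul _ _)
      _ ≤ |c - c'| * (‖B‖ * ‖P‖ * ‖(z : H)‖ * ‖β‖) := by
          gcongr
          refine (abs_real_inner_le_norm _ _).trans ?_
          gcongr
          exact norm_adjoint_apply_apply_le B P z
      _ = |c - c'| * (‖B‖ * ‖P‖) * ‖(z : H)‖ * ‖β‖ := by ring
  linarith [sq_nonneg (1 / 2 * ‖(z : H)‖ - 2 * (|c - c'| * (‖B‖ * ‖P‖)) * ‖β‖)]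

/-- Adding a multiple of the identity to `P` makes `-‖B* z‖²` available, which absorbs the change
of gain. -/
theorem exists_coercive_lyapunov_operator (hA : ∀ x : A.domain, ⟪A x, (x : H)⟫_ℝ ≤ 0) {c c' : ℝ}
    (hexp : GloballyExpStable (linearClosedLoop A B c)) (hc' : 0 < c') :
    ∃ P : H →L[ℝ] H, IsSelfAdjoint P ∧ (∃ α > 0, ∀ z : H, α * ‖z‖ ^ 2 ≤ ⟪P z, z⟫_ℝ) ∧
      ∀ z : A.domain, 2 * ⟪P z, linearClosedLoop A B c' z⟫_ℝ ≤ -(1 / 4) * ‖(z : H)‖ ^ 2 := by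
  obtain ⟨P, hsa, hpos, hlyap⟩ := hexp.exists_lyapunov_operator
  set N : ℝ := |c - c'| * (‖B‖ * ‖P‖)
  obtain ⟨M, hMpos, hM⟩ : ∃ M > 0, 2 * N ^ 2 ≤ M * c' := by
    refine ⟨2 * N ^ 2 / c' + 1, by positivity, ?_⟩
    rw [add_mul, div_mul_cancel₀ _ hc'.ne', one_mul]
    exact le_add_of_nonneg_right hc'.le
  have hinner : ∀ z w : H,
      ⟪(P + M • ContinuousLinearMap.id ℝ H) z, w⟫_ℝ = ⟪P z, w⟫_ℝ + M * ⟪z, w⟫_ℝ := fun z w => by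
    rw [← real_inner_smul_left, ← inner_add_left]
    rfl
  refine ⟨P + M • ContinuousLinearMap.id ℝ H,
    hsa.add ((IsSelfAdjoint.all M).smul (IsSelfAdjoint.one (H →L[ℝ] H))),
    ⟨M, hMpos, fun z => ?_⟩, fun z => ?_⟩
  · rw [hinner, real_inner_self_eq_norm_sq]
    exact le_add_of_nonneg_left (hpos z)
  · have hchange := two_mul_inner_linearClosedLoop_le A B P c c' z
    have habsorb : 2 * N ^ 2 * ‖ContinuousLinearMap.adjoint B (z : H)‖ ^ 2 ≤
        M * c' * ‖ContinuousLinearMap.adjoint B (z : H)‖ ^ 2 := by gcongr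
    have hAz : M * ⟪(z : H), A z⟫_ℝ ≤ 0 :=
      mul_nonpos_of_nonneg_of_nonpos hMpos.le (real_inner_comm (A z) (z : H) ▸ hA z)
    have hPz : 2 * ⟪P z, linearClosedLoop A B c z⟫_ℝ ≤ -(1 / 2) * ‖(z : H)‖ ^ 2 := hlyap z
    rw [hinner, inner_linearClosedLoop A B c' z, real_inner_self_eq_norm_sq]
    linarith

end LyapunovOperator

section LyapunovFunction

variable {H : Type*} [NormedAddCommGroup H] [InnerProductSpace ℝ H] {h : ℝ → ℝ} {M b : ℝ}

theorem continuous_sqrt_mul_gain (hh : Continuous h) (b : ℝ) :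
    Continuous fun v => √v * h (b * √v) := by fun_prop

theorem hasDerivAt_integral_gain (hh : Continuous h) (b x : ℝ) :
    HasDerivAt (fun x => ∫ v in (0 : ℝ)..x, √v * h (b * √v)) (√x * h (b * √x)) x :=
  (continuous_sqrt_mul_gain hh b).integral_hasStrictDerivAt 0 x |>.hasDerivAt

theorem contDiff_integral_gain (hh : Continuous h) (b : ℝ) :
    ContDiff ℝ 1 fun x => ∫ v in (0 : ℝ)..x, √v * h (b * √v) := by
  refine contDiff_one_iff_deriv.2 ⟨fun x => (hasDerivAt_integral_gain hh b x).differentiableAt, ?_⟩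
  rw [funext fun x => (hasDerivAt_integral_gain hh b x).deriv]
  exact continuous_sqrt_mul_gain hh b

theorem monotone_integral_gain (hh : IsGain h) (b : ℝ) :
    Monotone fun x => ∫ v in (0 : ℝ)..x, √v * h (b * √v) :=
  monotone_of_hasDerivAt_nonneg (hasDerivAt_integral_gain hh.continuous b)
    fun x => mul_nonneg (Real.sqrt_nonneg x) (hh.nonneg _)

theorem contDiff_lyapunovFunction (hh : Continuous h) (P : H →L[ℝ] H) (M b : ℝ) :
    ContDiff ℝ 1 (lyapunovFunction P M h b) :=
  (P.contDiff.inner ℝ contDiff_id).add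
    (contDiff_const.mul ((contDiff_integral_gain hh b).comp (contDiff_norm_sq ℝ)))

theorem fderiv_lyapunovFunction_apply [CompleteSpace H] (hh : Continuous h) {P : H →L[ℝ] H}
    (hP : IsSelfAdjoint P) (M b : ℝ) (z v : H) :
    fderiv ℝ (lyapunovFunction P M h b) z v =
      2 * ⟪P z, v⟫_ℝ + M * (‖z‖ * h (b * ‖z‖)) * (2 * ⟪z, v⟫_ℝ) := by
  have hsymm : ⟪P v, z⟫_ℝ = ⟪v, P z⟫_ℝ :=
    ContinuousLinearMap.isSelfAdjoint_iff_isSymmetric.1 hP v z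
  have hquad : HasFDerivAt (fun z => ⟪P z, z⟫_ℝ) _ z := P.hasFDerivAt.inner ℝ (hasFDerivAt_id z)
  have hgain := (hasDerivAt_integral_gain hh b (‖z‖ ^ 2)).comp_hasFDerivAt z
    (hasStrictFDerivAt_norm_sq z).hasFDerivAt
  have hV : HasFDerivAt (lyapunovFunction P M h b) _ z := hquad.add (hgain.const_mul M)
  rw [hV.fderiv]
  simp only [Real.sqrt_sq (norm_nonneg z), add_apply, smul_apply,
    ContinuousLinearMap.comp_apply, ContinuousLinearMap.prod_apply, ContinuousLinearMap.id_apply,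
    fderivInnerCLM_apply, coe_innerSL_apply, real_inner_comm, hsymm, nsmul_eq_mul, Nat.cast_ofNat,
    smul_eq_mul]
  ring

theorem isClassKInfty_mul_sq {a : ℝ} (ha : 0 < a) : IsClassKInfty fun r => a * r ^ 2 where
  continuousOn := by fun_prop
  strictMonoOn := fun x hx y _ hxy =>
    mul_lt_mul_of_pos_left (pow_lt_pow_left₀ hxy hx two_ne_zero) ha
  map_zero := by simp
  tendsto := (tendsto_pow_atTop two_ne_zero).const_mul_atTop ha

theorem IsClassKInfty.add_monotoneOn {ψ g : ℝ → ℝ} (hψ : IsClassKInfty ψ)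
    (hg : ContinuousOn g (Ici 0)) (hmono : MonotoneOn g (Ici 0)) (hg0 : g 0 = 0) :
    IsClassKInfty fun r => ψ r + g r where
  continuousOn := hψ.continuousOn.add hg
  strictMonoOn := hψ.strictMonoOn.add_monotone hmono
  map_zero := by rw [hψ.map_zero, hg0, add_zero]
  tendsto := by
    refine tendsto_atTop_mono' atTop ?_ hψ.tendsto
    filter_upwards [eventually_ge_atTop 0] with r hr
    exact le_add_of_nonneg_right (hg0 ▸ hmono self_mem_Ici hr hr)

theorem exists_isClassKInfty_lyapunovFunction_bounds (hh : IsGain h) {P : H →L[ℝ] H} {α : ℝ}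
    (hM : 0 ≤ M) (hα : 0 < α) (hP : ∀ z : H, α * ‖z‖ ^ 2 ≤ ⟪P z, z⟫_ℝ) :
    ∃ ψ₁ ψ₂ : ℝ → ℝ, IsClassKInfty ψ₁ ∧ IsClassKInfty ψ₂ ∧
      ∀ z : H, ψ₁ ‖z‖ ≤ lyapunovFunction P M h b z ∧ lyapunovFunction P M h b z ≤ ψ₂ ‖z‖ := by
  have hmono := monotone_integral_gain hh b
  have hcont := (contDiff_integral_gain hh.continuous b).continuous
  -- `‖P‖ + 1` rather than `‖P‖`, which vanishes when `H` is trivial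
  refine ⟨fun r => α * r ^ 2, fun r => (‖P‖ + 1) * r ^ 2 +
    M * ∫ v in (0 : ℝ)..(r ^ 2), √v * h (b * √v), isClassKInfty_mul_sq hα,
    (isClassKInfty_mul_sq (by positivity)).add_monotoneOn ?_ ?_ (by simp), fun z => ⟨?_, ?_⟩⟩
  · exact (continuous_const.mul (hcont.comp (continuous_pow 2))).continuousOn
  · exact fun x hx y _ hxy => mul_le_mul_of_nonneg_left (hmono (pow_le_pow_left₀ hx hxy 2)) hM
  · have hgain : 0 ≤ ∫ v in (0 : ℝ)..(‖z‖ ^ 2), √v * h (b * √v) := by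
      simpa using hmono (sq_nonneg ‖z‖)
    exact (hP z).trans (le_add_of_nonneg_right (mul_nonneg hM hgain))
  · have hquad : ⟪P z, z⟫_ℝ ≤ ‖P‖ * ‖z‖ * ‖z‖ :=
      (real_inner_le_norm _ _).trans (mul_le_mul_of_nonneg_right (P.le_opNorm z) (norm_nonneg z))
    rw [lyapunovFunction]
    linarith [sq_nonneg ‖z‖]

theorem isStrictGlobalLyapunov_of_dissipation {D : Submodule ℝ H} {F : D → H} {V : H → ℝ} {C : ℝ}
    (hV : ContDiff ℝ 1 V)
    (hbounds : ∃ ψ₁ ψ₂ : ℝ → ℝ, IsClassKInfty ψ₁ ∧ IsClassKInfty ψ₂ ∧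
      ∀ z : H, ψ₁ ‖z‖ ≤ V z ∧ V z ≤ ψ₂ ‖z‖)
    (hC : 0 < C) (hdiss : ∀ z : D, fderiv ℝ V (z : H) (F z) ≤ -C * ‖(z : H)‖ ^ 2) :
    IsStrictGlobalLyapunov F V C where
  contDiff := hV
  bounds := hbounds
  rate_pos := hC
  dissipation := hdiss
  along_solutions := fun τ z _ hz => by
    refine ⟨absolutelyContinuousOnInterval_comp_of_contDiff hV hz.absCont, ?_⟩
    filter_upwards [hz.ode] with t ht htτ
    obtain ⟨hmem, hder⟩ := ht htτ
    exact ⟨_, ((hV.differentiable one_ne_zero) (z t)).hasFDerivAt.comp_hasDerivAt t hder,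
      hdiss ⟨z t, hmem⟩⟩

end LyapunovFunction

section Global

variable {H : Type*} [NormedAddCommGroup H] [InnerProductSpace ℝ H] [CompleteSpace H]
  {U : Type*} [NormedAddCommGroup U] [InnerProductSpace ℝ U] [CompleteSpace U]
  {S : Type*} [NormedAddCommGroup S] [NormedSpace ℝ S]
  {A : H →ₗ.[ℝ] H} {B : U →L[ℝ] H} {ι : S →L[ℝ] U} {σ : U → S} {C₁ C₂ : ℝ} {h : ℝ → ℝ}

theorem DampingInequality.inner_add_feedback_le (hC₂ : 0 < C₂) (hh : IsGain h)
    (hdamp : DampingInequality ι σ C₁ C₂ h) (hiso : Isometry ι) (hsurj : Function.Surjective ι)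
    (P : H →L[ℝ] H) (z : A.domain) :
    ⟪P z, A z + feedback B (fun u => ι (σ u)) z⟫_ℝ ≤ ⟪P z, linearClosedLoop A B C₁ z⟫_ℝ +
      ‖B‖ * ‖P‖ * C₂ * (‖(z : H)‖ * h (‖B‖ * ‖(z : H)‖)) *
        ⟪ι (σ (ContinuousLinearMap.adjoint B (z : H))),
          ContinuousLinearMap.adjoint B (z : H)⟫_ℝ := by
  rw [inner_linearClosedLoop, inner_add_right, inner_feedback]
  obtain ⟨s, hs⟩ := hsurj (ContinuousLinearMap.adjoint B (z : H))
  have hθ := hdamp.inner_nonneg hC₂ hh s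
  have hsz : h ‖ι s‖ ≤ h (‖B‖ * ‖(z : H)‖) := hh.mono (hs ▸ norm_adjoint_apply_le B _)
  rw [← hs]
  have hdefect : -⟪ContinuousLinearMap.adjoint B (P z), ι (σ (ι s)) - C₁ • ι s⟫_ℝ ≤
      ‖B‖ * ‖P‖ * ‖(z : H)‖ * (C₂ * h (‖B‖ * ‖(z : H)‖) * ⟪ι (σ (ι s)), ι s⟫_ℝ) := by
    refine (neg_le_abs _).trans ((abs_real_inner_le_norm _ _).trans (mul_le_mul
      (norm_adjoint_apply_apply_le B P z) ?_ (norm_nonneg _) (by positivity)))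
    refine (hdamp.norm_sub_le hiso hsurj (ι s)).trans ?_
    gcongr
  rw [inner_sub_right, real_inner_smul_right] at hdefect
  linarith

theorem exists_strictGlobalLyapunov (hA : ∀ x : A.domain, ⟪A x, (x : H)⟫_ℝ ≤ 0) {c : ℝ}
    (hexp : GloballyExpStable (linearClosedLoop A B c)) (hC₁ : 0 < C₁) (hC₂ : 0 < C₂)
    (hh : IsGain h) (hdamp : DampingInequality ι σ C₁ C₂ h) (hiso : Isometry ι)
    (hsurj : Function.Surjective ι) :
    ∃ (P : H →L[ℝ] H) (M C : ℝ), IsSelfAdjoint P ∧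
      (∃ α > 0, ∀ z : H, α * ‖z‖ ^ 2 ≤ ⟪P z, z⟫_ℝ) ∧
      (∀ z : A.domain,
        ⟪linearClosedLoop A B C₁ z, P z⟫_ℝ + ⟪P z, linearClosedLoop A B C₁ z⟫_ℝ
          ≤ -C * ‖(z : H)‖ ^ 2) ∧
      0 < M ∧
      IsStrictGlobalLyapunov (fun x : A.domain => A x + feedback B (fun u => ι (σ u)) x)
        (lyapunovFunction P M h ‖B‖) C := by
  obtain ⟨P, hsa, ⟨α, hα, hcoer⟩, hlyap⟩ := exists_coercive_lyapunov_operator hA hexp hC₁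
  have hM : 0 < ‖B‖ * ‖P‖ * C₂ + 1 := by positivity
  refine ⟨P, ‖B‖ * ‖P‖ * C₂ + 1, 1 / 4, hsa, ⟨α, hα, hcoer⟩, fun z => ?_, hM,
    isStrictGlobalLyapunov_of_dissipation (contDiff_lyapunovFunction hh.continuous P _ _)
      (exists_isClassKInfty_lyapunovFunction_bounds hh hM.le hα hcoer) (by norm_num) fun z => ?_⟩
  · rw [real_inner_comm]
    linarith [hlyap z]
  · obtain ⟨s, hs⟩ := hsurj (ContinuousLinearMap.adjoint B (z : H))
    have hP := hdamp.inner_add_feedback_le (B := B) hC₂ hh hiso hsurj P z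
    rw [← hs] at hP
    have hθ := hdamp.inner_nonneg hC₂ hh s
    have hw : 0 ≤ ‖(z : H)‖ * h (‖B‖ * ‖(z : H)‖) := mul_nonneg (norm_nonneg _) (hh.nonneg _)
    have hAz := mul_nonpos_of_nonneg_of_nonpos (mul_nonneg hM.le hw) (hA z)
    rw [fderiv_lyapunovFunction_apply hh.continuous hsa, inner_add_feedback hs]
    linarith [hlyap z, mul_nonneg hw hθ]

end Global

theorem mainTheorem1_general
    {H : Type*} [NormedAddCommGroup H] [InnerProductSpace ℝ H] [CompleteSpace H]
    {U : Type*} [NormedAddCommGroup U] [InnerProductSpace ℝ U] [CompleteSpace U]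
    {S : Type*} [NormedAddCommGroup S] [NormedSpace ℝ S]
    (ι : S →L[ℝ] U)
    (A : H →ₗ.[ℝ] H) (hA : GeneratesContractionSemigroup A)
    (B : U →L[ℝ] H) (k : ℝ) (hk : 0 < k)
    (hexp : GloballyExpStable (linearClosedLoop A B k))
    (σ : U → S) (hσ : LocallyLipschitz (fun u => ι (σ u)))
    (C₁ C₂ : ℝ) (hC₁ : 0 < C₁) (hC₂ : 0 < C₂)
    (h : ℝ → ℝ) (hh : IsGain h) (hdamp : DampingInequality ι σ C₁ C₂ h) :
    (Isometry ι → Function.Surjective ι →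
      ∃ (P : H →L[ℝ] H) (M C : ℝ), IsSelfAdjoint P ∧
        (∃ α > 0, ∀ z : H, α * ‖z‖ ^ 2 ≤ ⟪P z, z⟫_ℝ) ∧
        (∀ z : A.domain,
          ⟪linearClosedLoop A B (k * C₁) z, P z⟫_ℝ + ⟪P z, linearClosedLoop A B (k * C₁) z⟫_ℝ
            ≤ -C * ‖(z : H)‖ ^ 2) ∧
        0 < M ∧
        IsStrictGlobalLyapunov (nonlinearClosedLoop A B k ι σ)
          (lyapunovFunction P M h (√k * ‖B‖)) C) ∧
    (MonotoneDamping ι σ →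
      (∀ R : ℝ, ∃ L : ℝ, ∀ u : U, ‖u‖ ≤ R → ‖ι (σ u)‖ ≤ L) →
      (∃ cS : ℝ, ∀ z : A.domain, ∃ s : S,
        ι s = ContinuousLinearMap.adjoint B (z : H) ∧ ‖s‖ ≤ cS * graphNorm A z) →
      SemiGloballyExpStable A (nonlinearClosedLoop A B k ι σ)) := by
  have hnorm : ‖√k • B‖ = √k * ‖B‖ := by
    rw [norm_smul, Real.norm_of_nonneg (Real.sqrt_nonneg k)]
  have hexp' : GloballyExpStable (linearClosedLoop A (√k • B) 1) := by
    rwa [linearClosedLoop_sqrt_smul A B hk.le, mul_one]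
  rw [nonlinearClosedLoop_eq, ← hnorm]
  refine ⟨fun hiso hsurj => ?_, fun hmono hbdd ⟨cS, hS⟩ => ?_⟩
  · obtain ⟨T, hT, hgen⟩ := hA.exists_isContractionSemigroup
    obtain ⟨P, M, C, hsa, hcoer, hlyap, hV⟩ :=
      exists_strictGlobalLyapunov (hgen.inner_nonpos hT) hexp' hC₁ hC₂ hh hdamp hiso hsurj
    refine ⟨P, M, C, hsa, hcoer, fun z => ?_, hV⟩
    rw [← linearClosedLoop_sqrt_smul_apply A B hk.le]
    exact hlyap z
  · refine semiGloballyExpStable_of_monotone hA hexp' hσ hC₁ hC₂ hh hdamp hmono hbdd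
      (cS := √k * cS) fun z => ?_
    obtain ⟨s, hs, hsz⟩ := hS z
    refine ⟨√k • s, by simp [hs], ?_⟩
    rw [norm_smul, Real.norm_of_nonneg (Real.sqrt_nonneg k), mul_assoc]
    gcongr

end NonlinearDamping

theorem mainTheorem1
    {H : Type*} [NormedAddCommGroup H] [InnerProductSpace ℝ H] [CompleteSpace H]
    {U : Type*} [NormedAddCommGroup U] [InnerProductSpace ℝ U] [CompleteSpace U]
    {S : Type*} [NormedAddCommGroup S] [NormedSpace ℝ S] [CompleteSpace S]
    (ι : S →L[ℝ] U) (hι : IsRigging ι)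
    (A : H →ₗ.[ℝ] H) (hA : GeneratesContractionSemigroup A)
    (B : U →L[ℝ] H) (k : ℝ) (hk : 0 < k)
    (hexp : GloballyExpStable (linearClosedLoop A B k))
    (σ : U → S) (hσ : LocallyLipschitz (fun u => ι (σ u)))
    (C₁ C₂ : ℝ) (hC₁ : 0 < C₁) (hC₂ : 0 < C₂)
    (h : ℝ → ℝ) (hh : IsGain h) (hdamp : DampingInequality ι σ C₁ C₂ h) :
    -- the case `S = U`
    (Isometry ι → Function.Surjective ι →
      ∃ (P : H →L[ℝ] H) (M C : ℝ), IsSelfAdjoint P ∧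
        (∃ α > 0, ∀ z : H, α * ‖z‖ ^ 2 ≤ ⟪P z, z⟫_ℝ) ∧
        (∀ z : A.domain,
          ⟪linearClosedLoop A B (k * C₁) z, P z⟫_ℝ + ⟪P z, linearClosedLoop A B (k * C₁) z⟫_ℝ
            ≤ -C * ‖(z : H)‖ ^ 2) ∧
        0 < M ∧
        IsStrictGlobalLyapunov (nonlinearClosedLoop A B k ι σ)
          (lyapunovFunction P M h (√k * ‖B‖)) C) ∧
    -- the general case
    (MonotoneDamping ι σ →
      (∀ R : ℝ, ∃ L : ℝ, ∀ u : U, ‖u‖ ≤ R → ‖ι (σ u)‖ ≤ L) →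
      (∃ cS : ℝ, ∀ z : A.domain, ∃ s : S,
        ι s = ContinuousLinearMap.adjoint B (z : H) ∧ ‖s‖ ≤ cS * graphNorm A z) →
      SemiGloballyExpStable A (nonlinearClosedLoop A B k ι σ)) :=
  mainTheorem1_general ι A hA B k hk hexp σ hσ C₁ C₂ hC₁ hC₂ h hh hdamp
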